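/- Let $G_7$ be the graph obtained from the complete graph $K_6$ on the vertices $1,\dots,6$ by one $\Delta$–Y exchange at the triangle $\{4,5,6\}$: the edges $45$, $46$, $56$ are removed and a new vertex $7$ is joined to $4$, $5$ and $6$. A subgraph $M$ of $G_7$ is maximal planar if it is planar and no planar subgraph of $G_7$ properly contains it. Then the maximal planar subgraphs of $G_7$ are, up to automorphisms of $G_7$, precisely the following six, no two of which are equivalent under an automorphism of $G_7$: $$G_7-\{67,14\},\quad G_7-\{14,25,36\},\quad G_7-\{14,43,36\},\quad G_7-\{41,13,36\},\quad G_7-\{76,63,32\},\quad G_7-\{31,14,42\}.$$ Moreover, for every maximal planar subgraph $M$ of $G_7$ and every embedding of $M$ in the sphere $S^2$, the strong conflict graph is unbalanced. Here the strong conflict graph of an embedding $M\subset S^2\subset S^3$ is the signed graph whose vertices are the edges of $G_7$ not in $M$. Two such edges $e\neq f$ are joined by a negative edge if they strongly conflict, that is, if every placement of $e$ and $f$ on the same side of $S^2$ produces two disjoint cycles of $M\cup e\cup f$ with nonzero linking number. They are joined by a positive edge if they strongly anti-conflict, that is, if every placement of $e$ and $f$ on opposite sides of $S^2$ produces two disjoint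 cycles of $M\cup e\cup f$ with nonzero linking number. (They may be joined by both, which gives a circle of length two.) A signed graph is balanced if the product of the signs along every circle is positive, and unbalanced otherwise. -/

import Mathlib

/-! ### Plane embeddings of finite graphs, given by rotation systems of genus zero -/

/-- A rotation system of genus zero on a finite simple graph, that is (for a connected graph) an
embedding of the graph into the oriented sphere, up to orientation preserving homeomorphism.
`next d` is the dart that follows `d` in the cyclic order of the darts leaving the vertex `d.fst`. -/
structure PlaneEmbedding {V : Type*} [Finite V] (G : SimpleGraph V) where
  /-- the rotation -/
  next : Equiv.Perm G.Dart
  /-- the cycles of the rotation are the sets of darts leaving a common vertex -/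
  sameCycle_iff : ∀ d d' : G.Dart, next.SameCycle d d' ↔ d.fst = d'.fst
  /-- Euler's formula `V - E + F = 2` for every connected component, in total. The faces of a
  component with at least one edge are the cycles of `d ↦ next d.symm` on its darts; the single
  face of an isolated vertex has no dart on its boundary and is counted separately. -/
  euler : Nat.card V +
      (Nat.card (Quotient (Equiv.Perm.SameCycle.setoid
        (next * Function.Involutive.toPerm _ (SimpleGraph.Dart.symm_involutive (G := G))))) +
        Nat.card {v : V // ∀ w, ¬ G.Adj v w}) =
    Nat.card G.edgeSet + 2 * Nat.card G.ConnectedComponent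

/-- A finite graph is planar if it has a plane embedding. -/
def IsPlanar {V : Type*} [Finite V] (G : SimpleGraph V) : Prop := Nonempty (PlaneEmbedding G)

/-- A maximal planar subgraph of `G`: a planar subgraph that is contained in no other planar
subgraph. (Isolated vertices do not matter for planarity, so the subgraph may be regarded as a
graph on all vertices of `G` when its planarity is tested.) -/
def IsMaximalPlanarSubgraph {V : Type*} [Finite V] {G : SimpleGraph V} (M : G.Subgraph) : Prop :=
  Maximal (fun H : G.Subgraph => IsPlanar H.spanningCoe) M

namespace PlaneEmbedding

variable {V : Type*} [Finite V] {M : SimpleGraph V}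

/-- The permutation that takes a dart to the next dart along the face on its chosen side. -/
def faceNext (P : PlaneEmbedding M) : Equiv.Perm M.Dart :=
  P.next * Function.Involutive.toPerm _ (SimpleGraph.Dart.symm_involutive (G := M))

/-- The faces of a plane embedding. -/
def Face (P : PlaneEmbedding M) : Type _ := Quotient (Equiv.Perm.SameCycle.setoid P.faceNext)

/-- The face that has the dart `d` on its boundary, on the chosen side of `d`. The face on the
other side of the edge of `d` is `P.face d.symm`. As `d` runs over the darts that leave a vertex,
`P.face d` runs over the faces at the corners of this vertex. -/
def face (P : PlaneEmbedding M) (d : M.Dart) : P.Face :=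
  Quotient.mk (Equiv.Perm.SameCycle.setoid P.faceNext) d

/-- A generic curve in the sphere from one face to another, avoiding the vertices, recorded by the
edges that it crosses. The constructor `cross d` starts with a crossing of the edge of `d`, from
the face on the chosen side of `d` to the face on the other side. -/
inductive Curve (P : PlaneEmbedding M) : P.Face → P.Face → Type _
  | nil (F : P.Face) : Curve P F F
  | cross (d : M.Dart) {F : P.Face} (c : Curve P (P.face d.symm) F) : Curve P (P.face d) F

open Classical in
/-- The signed number of crossings of a curve with the edge of the dart `x`, oriented as `x`. -/
noncomputable def Curve.crossings {P : PlaneEmbedding M} {F F' : P.Face} :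
    Curve P F F' → M.Dart → ℤ
  | .nil _, _ => 0
  | .cross d c, x => (if x = d then 1 else 0) - (if x = d.symm then 1 else 0) + c.crossings x

/-- The generic projection to the sphere of an arc that joins the vertices `a` and `b` and has no
other point in common with the embedded graph: it leaves `a` into the face at some corner of `a`
and arrives at `b` from the face at some corner of `b`. -/
structure Arc (P : PlaneEmbedding M) (a b : V) where
  /-- the corner at which the projection leaves `a` -/
  start : M.Dart
  start_fst : start.fst = a
  /-- the corner at which the projection arrives at `b` -/
  finish : M.Dart
  finish_fst : finish.fst = b
  /-- the remainder of the projection -/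
  curve : Curve P (P.face start) (P.face finish)

/-- The signed number of crossings of the projection of an arc with a walk in the embedded graph. -/
noncomputable def Arc.inter {P : PlaneEmbedding M} {a b u v : V} (A : P.Arc a b)
    (w : M.Walk u v) : ℤ :=
  (w.darts.map A.curve.crossings).sum

/-- Let `M` be connected and embedded in a sphere in the 3-sphere, and let `e` and `f` be two further
edges. They strongly conflict if, whenever both are placed on the same side of the sphere, the
resulting spatial graph has two disjoint cycles with nonzero linking number.

Let the side be the upper one. A placement has a diagram given by the projection `A` of the arc
`e`, oriented from `a` to `b`, the projection of the arc `f`, oriented from `c` to `d`, and the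
crossings of these two arcs. Let `n` be the signed number of the crossings at which `e` passes over
`f`; it can be any integer. The linking number of two disjoint cycles is the signed number of the
crossings at which the first passes over the second. A cycle in `M` is never linked with a disjoint
cycle in this placement, as it can be pushed below the sphere. The other pairs consist of a
cycle `e ∪ p` and a cycle `f ∪ q` with disjoint paths `p` and `q` in `M`; here the crossings to be
counted are those of `e` over `f` and those of `e` over `q`. -/
def StronglyConflict (P : PlaneEmbedding M) (e f : Sym2 V) : Prop :=
  ∀ a b c d : V, e = s(a, b) → f = s(c, d) → ∀ (A : P.Arc a b) (n : ℤ),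
    ∃ (p : M.Walk b a) (q : M.Walk d c), p.IsPath ∧ q.IsPath ∧ p.support.Disjoint q.support ∧
      n + A.inter q ≠ 0

/-- Let `M` be connected and embedded in a sphere in the 3-sphere, and let `e` and `f` be two further
edges. They strongly anti-conflict if, whenever they are placed on opposite sides of the sphere, the
resulting spatial graph has two disjoint cycles with nonzero linking number.

Let `e` be above and `f` below the sphere. Two disjoint cycles are unlinked if each contains at most
one of `e` and `f`, as they can be pushed apart. The other pairs consist of a cycle `q` in `M` and a
cycle `e ∪ p ∪ f ∪ p'` with paths `p` and `p'` in `M` (either may be a single vertex). In a diagram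
whose arc `e` has the projection `A`, the second of these cycles passes over `q` precisely at the
crossings of `e` over `q`, and their signed number is the linking number. -/
def StronglyAntiConflict (P : PlaneEmbedding M) (e f : Sym2 V) : Prop :=
  ∀ a b : V, e = s(a, b) → ∀ A : P.Arc a b,
    ∃ (c d : V) (p : M.Walk b c) (p' : M.Walk d a) (x : V) (q : M.Walk x x), f = s(c, d) ∧
      p.IsPath ∧ p'.IsPath ∧ q.IsCycle ∧ p.support.Disjoint p'.support ∧
      q.support.Disjoint p.support ∧ q.support.Disjoint p'.support ∧ A.inter q ≠ 0

end PlaneEmbedding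

/-! ### Signed graphs and the strong conflict graph -/

/-- A signed graph without loops: each pair of distinct vertices may be joined by a positive edge,
a negative edge, both or none. -/
structure SignedGraph (W : Type*) where
  /-- `Adj s x y`: there is an edge of sign `s` between `x` and `y` -/
  Adj : ℤˣ → W → W → Prop
  symm : ∀ s x y, Adj s x y → Adj s y x
  loopless : ∀ s x, ¬ Adj s x x

/-- A signed graph is balanced if the product of the signs of the edges of every circle is positive.
Circles of length two are pairs of parallel edges. (Traversing one edge back and forth is not
excluded below, but it has a positive product anyway.) -/
def SignedGraph.IsBalanced {W : Type*} (S : SignedGraph W) : Prop :=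
  ∀ (n : ℕ) (v : Fin (n + 1) → W) (s : Fin (n + 1) → ℤˣ), Function.Injective v →
    (∀ i, S.Adj (s i) (v i) (v (i + 1))) → ∏ i, s i = 1

/-- The strong conflict graph of a plane embedding of a connected spanning subgraph `M` of `G`. The
`M`-fragments are the edges of `G` that are not in `M`; a negative edge joins two fragments that
strongly conflict and a positive edge joins two fragments that strongly anti-conflict. (The two
relations are symmetric, and both orders are listed to make this evident.) -/
def strongConflictGraph {V : Type*} [Finite V] (G : SimpleGraph V) {M : SimpleGraph V}
    (P : PlaneEmbedding M) : SignedGraph ↥(G.edgeSet \ M.edgeSet) where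
  Adj s e f := e ≠ f ∧
    ((s = -1 ∧ (P.StronglyConflict e f ∨ P.StronglyConflict f e)) ∨
      (s = 1 ∧ (P.StronglyAntiConflict e f ∨ P.StronglyAntiConflict f e)))
  symm := fun _ _ _ h => ⟨h.1.symm, h.2.imp (fun h => ⟨h.1, h.2.symm⟩) (fun h => ⟨h.1, h.2.symm⟩)⟩
  loopless := fun _ _ h => h.1 rfl

/-! ### The graph `G₇` and the six subgraphs -/

/-- The Δ–Y exchange at the triangle `a, b, c` of `G`: the edges of the triangle are removed, and
a new vertex `none` is joined to `a`, `b` and `c`. -/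
def deltaY {V : Type*} (G : SimpleGraph V) (a b c : V) : SimpleGraph (Option V) :=
  SimpleGraph.fromRel fun x y =>
    (∃ u v, x = some u ∧ y = some v ∧ G.Adj u v ∧
      s(u, v) ≠ s(a, b) ∧ s(u, v) ≠ s(b, c) ∧ s(u, v) ≠ s(a, c)) ∨
    (x = none ∧ (y = some a ∨ y = some b ∨ y = some c))

/-- The graph `G₇` of the Petersen family, obtained from `K₆` by one Δ–Y exchange. -/
def G7 : SimpleGraph (Option (Fin 6)) := deltaY (⊤ : SimpleGraph (Fin 6)) 3 4 5

/-- The edges that are removed from `G₇` to obtain each of the six subgraphs. -/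
def removedEdges : Fin 6 → Set (Sym2 (Option (Fin 6))) :=
  ![{s(some 5, none), s(some 0, some 3)},
    {s(some 0, some 3), s(some 1, some 4), s(some 2, some 5)},
    {s(some 0, some 3), s(some 3, some 2), s(some 2, some 5)},
    {s(some 3, some 0), s(some 0, some 2), s(some 2, some 5)},
    {s(none, some 5), s(some 5, some 2), s(some 2, some 1)},
    {s(some 2, some 0), s(some 0, some 3), s(some 3, some 1)}]

/-- The six subgraphs of `G₇`. -/
def sixSubgraphs (i : Fin 6) : G7.Subgraph := (⊤ : G7.Subgraph).deleteEdges (removedEdges i)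

/-!
The whole argument takes place modulo two. In a plane embedding of genus zero every cycle bounds:
by Euler's formula, the space of functions on the edges that are coboundaries of functions on the
faces has the dimension of the cycle space, hence is equal to it
(`PlaneEmbedding.range_faceCoboundary`). So every closed walk has a *winding function* on the faces,
which changes precisely at the edges of the walk. A vertex off the walk has one winding number, the
ends of an edge whose two ends are off the walk have the same one, and a curve that joins two faces
crosses the walk an odd number of times if and only if their winding numbers differ.

The cyclic order of the darts at a vertex enters through `IsWinding.face_add_face_ne`: among three
darts at a vertex, two closed curves that share one of them interleave in precisely one of two
ways. From this we get a criterion, independent of the embedding, for a cycle `C` to have the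
vertices `a` and `b` on different sides (`SeparatingConfiguration.separates`). Its typical
instances are `K₃,₃` and `K₅` with one edge `ab` removed, where `C` is the cycle of edges disjoint
from `ab`; for `a = b` the criterion shows that subdivisions of `K₃,₃` and `K₅` are not planar.

* *Maximal planar subgraphs.* Every set of edges that meets each of the 43 images under
  automorphisms of six Kuratowski subgraphs of `G₇` contains an image of one of the six removed
  sets; this is settled by a verified search (`hittingSearch`). So every planar subgraph lies in an
  image of one of the six subgraphs. These are planar by explicit rotation systems, and no
  inclusions hold between their images but equalities, by inspection of the 36 automorphisms.

* *Strong conflicts.* If two paths `q`, `q'` for `f` together separate the ends of `e`, an arc for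
  `e` crosses one of them an odd and the other an even number of times, so one of the linking
  numbers `n + A.inter q` and `n + A.inter q'` is nonzero. If one or several cycles together
  separate the ends of `e`, then an arc for `e` crosses one of them an odd number of times, and a
  nonzero linking number results if these cycles are disjoint from a cycle through `e` and `f`.

* *Unbalanced.* With separating configurations in the six graphs it follows that the strong conflict
  graph contains a pair of parallel edges of opposite signs for the first graph, a triangle of three
  negative edges for the second one, and a triangle of two positive edges and a negative one for the
  other four, whatever the embedding.
-/

/-! ### Cycles bound in genus zero -/

namespace PlaneEmbedding

section Winding

open Classical in
/-- The incidence matrix over the field with two elements. Its kernel is the cycle space, and the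
kernel of its transpose consists of the functions that are constant on the components. -/
noncomputable def incidence {V : Type*} (M : SimpleGraph V) : Matrix V M.edgeSet (ZMod 2) :=
  Matrix.of fun v e => if v ∈ (e : Sym2 V) then 1 else 0

/-- The transpose of the incidence matrix is the coboundary operator on functions on the vertices.
-/
theorem incidence_transpose_mulVec {V : Type*} [Fintype V] (M : SimpleGraph V)
    (g : V → ZMod 2) (d : M.Dart) :
    (incidence M).transpose.mulVec g ⟨d.edge, d.edge_mem⟩ = g d.fst + g d.snd := by
  classical
  have h : ∀ v : V, (incidence M).transpose ⟨d.edge, d.edge_mem⟩ v * g v =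
      (if v = d.fst then g v else 0) + (if v = d.snd then g v else 0) := by
    intro v
    have hne : d.fst ≠ d.snd := d.adj.ne
    simp only [incidence, Matrix.transpose_apply, Matrix.of_apply, SimpleGraph.Dart.edge]
    by_cases h1 : v = d.fst
    · subst h1; simp [hne]
    · by_cases h2 : v = d.snd
      · subst h2; simp [hne.symm]
      · simp [h1, h2]
  simp only [Matrix.mulVec, dotProduct, h, Finset.sum_add_distrib]
  simp

theorem exists_dart_edge {V : Type*} {M : SimpleGraph V} (e : M.edgeSet) :
    ∃ d : M.Dart, d.edge = e := by
  obtain ⟨e, he⟩ := e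
  induction e with | _ u v => exact ⟨⟨(u, v), he⟩, rfl⟩

variable {V : Type*} [Finite V] {M : SimpleGraph V}

instance finite_dart : Finite M.Dart := by
  classical
  have := Fintype.ofFinite V
  infer_instance

/-- Functions that are constant on components are determined by their values on one vertex in each
component. -/
theorem finrank_ker_incidence_transpose_le [Fintype V] [Fintype M.edgeSet] :
    Module.finrank (ZMod 2) (LinearMap.ker (incidence M).transpose.mulVecLin) ≤
      Nat.card M.ConnectedComponent := by
  classical
  have := Fintype.ofFinite M.ConnectedComponent
  have hadj : ∀ g ∈ LinearMap.ker (incidence M).transpose.mulVecLin, ∀ u v, M.Reachable u v →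
      g u = g v := by
    rintro g hg u v ⟨w⟩
    induction w with
    | nil => rfl
    | cons h _ ih =>
      rw [← ih]
      have := congrFun (LinearMap.mem_ker.1 hg) ⟨_, (⟨(_, _), h⟩ : M.Dart).edge_mem⟩
      rw [Matrix.mulVecLin_apply, incidence_transpose_mulVec] at this
      exact CharTwo.add_eq_zero.1 this
  rw [Nat.card_eq_fintype_card, ← Module.finrank_fintype_fun_eq_card (ZMod 2)]
  refine LinearMap.finrank_le_finrank_of_injective
    (f := (LinearMap.funLeft (ZMod 2) (ZMod 2) fun c : M.ConnectedComponent => c.out).comp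
      (LinearMap.ker (incidence M).transpose.mulVecLin).subtype) ?_
  rw [← LinearMap.ker_eq_bot, LinearMap.ker_eq_bot']
  rintro ⟨g, hg⟩ h0
  ext v
  exact (hadj g hg _ v (SimpleGraph.ConnectedComponent.exact (Quot.out_eq _))).symm.trans
    (congrFun h0 (M.connectedComponentMk v))

variable (P : PlaneEmbedding M)

instance finite_face : Finite P.Face := by unfold Face; infer_instance

theorem face_next (d : M.Dart) : P.face (P.next d) = P.face d.symm :=
  Quotient.sound (Equiv.Perm.SameCycle.symm
    ⟨1, by simp [faceNext, Function.Involutive.toPerm]⟩)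

theorem next_fst (d : M.Dart) : (P.next d).fst = d.fst :=
  ((P.sameCycle_iff d (P.next d)).1 ⟨1, by simp⟩).symm

/-- The coboundary operator from functions on the faces to functions on the edges: the value at an
edge is the sum of the values at the faces on its two sides. -/
noncomputable def faceCoboundary : (P.Face → ZMod 2) →ₗ[ZMod 2] (M.edgeSet → ZMod 2) :=
  LinearMap.funLeft (ZMod 2) (ZMod 2) (fun e => P.face (exists_dart_edge e).choose) +
    LinearMap.funLeft (ZMod 2) (ZMod 2) (fun e => P.face (exists_dart_edge e).choose.symm)

theorem faceCoboundary_apply (W : P.Face → ZMod 2) (d : M.Dart) :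
    P.faceCoboundary W ⟨d.edge, d.edge_mem⟩ = W (P.face d) + W (P.face d.symm) := by
  have h := (exists_dart_edge (⟨d.edge, d.edge_mem⟩ : M.edgeSet)).choose_spec
  rcases (SimpleGraph.dart_edge_eq_iff _ _).1 h with h | h
  · simp [faceCoboundary, LinearMap.funLeft_apply, h]
  · simp [faceCoboundary, LinearMap.funLeft_apply, h, add_comm]

/-- Around a vertex, each corner occurs once on the left and once on the right of a dart, so that
coboundaries lie in the cycle space. -/
theorem range_faceCoboundary_le [Fintype M.edgeSet] :
    LinearMap.range P.faceCoboundary ≤ LinearMap.ker (incidence M).mulVecLin := by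
  classical
  have := Fintype.ofFinite M.Dart
  rintro _ ⟨W, rfl⟩
  rw [LinearMap.mem_ker, Matrix.mulVecLin_apply]
  ext v
  have h1 : (incidence M).mulVec (P.faceCoboundary W) v =
      ∑ d : M.Dart with d.fst = v, (W (P.face d) + W (P.face (P.next d))) := by
    simp only [Matrix.mulVec, dotProduct, incidence, Matrix.of_apply, ite_mul, one_mul, zero_mul]
    rw [← Finset.sum_filter]
    refine (Finset.sum_bij (fun d _ => ⟨d.edge, d.edge_mem⟩) ?_ ?_ ?_ ?_).symm
    · intro d hd
      simp only [Finset.mem_filter, Finset.mem_univ, true_and] at hd ⊢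
      rw [← hd]; exact Sym2.mem_mk_left _ _
    · intro d hd d' hd' h
      simp only [Finset.mem_filter, Finset.mem_univ, true_and] at hd hd'
      rcases (SimpleGraph.dart_edge_eq_iff _ _).1 (congrArg Subtype.val h) with h | h
      · exact h
      · have : d.fst = d'.snd := by rw [h]; rfl
        exact absurd (hd'.trans (hd.symm.trans this)) d'.adj.ne
    · rintro ⟨e, he⟩ hv
      simp only [Finset.mem_filter, Finset.mem_univ, true_and] at hv
      obtain ⟨w, rfl⟩ := hv
      exact ⟨⟨(v, w), he⟩, by simp, rfl⟩
    · intro d _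
      rw [faceCoboundary_apply, face_next]
  rw [h1, Finset.sum_add_distrib]
  have h2 : ∑ d : M.Dart with d.fst = v, W (P.face (P.next d)) =
      ∑ d : M.Dart with d.fst = v, W (P.face d) :=
    Finset.sum_equiv P.next (by simp [next_fst]) (by simp)
  rw [h2]
  exact CharTwo.add_self_eq_zero _

/-- A function on the faces whose coboundary vanishes is constant on the darts of each component,
and a component without darts is an isolated vertex. -/
theorem finrank_ker_faceCoboundary_add_le [Fintype V] [Fintype M.edgeSet] :
    Module.finrank (ZMod 2) (LinearMap.ker P.faceCoboundary) +
      Nat.card {v : V // ∀ w, ¬ M.Adj v w} ≤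
    Module.finrank (ZMod 2) (LinearMap.ker (incidence M).transpose.mulVecLin) := by
  classical
  have := Fintype.ofFinite P.Face
  have hconst : ∀ W ∈ LinearMap.ker P.faceCoboundary, ∀ d d' : M.Dart, d.fst = d'.fst →
      W (P.face d) = W (P.face d') := by
    intro W hW d d' h
    have hs : ∀ d : M.Dart, W (P.face (P.next d)) = W (P.face d) := by
      intro d
      have := congrFun (LinearMap.mem_ker.1 hW) ⟨d.edge, d.edge_mem⟩
      rw [faceCoboundary_apply] at this
      rw [face_next]
      exact (CharTwo.add_eq_zero.1 this).symm
    obtain ⟨n, rfl⟩ := ((P.sameCycle_iff d d').2 h).exists_nat_pow_eq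
    clear h
    induction n with
    | zero => rfl
    | succ n ih => rw [pow_succ', Equiv.Perm.mul_apply, hs, ih]
  have hd : ∀ v : V, ¬ (∀ w, ¬ M.Adj v w) → ∃ d : M.Dart, d.fst = v := by
    intro v hv
    push Not at hv
    obtain ⟨w, hw⟩ := hv
    exact ⟨⟨(v, w), hw⟩, rfl⟩
  choose d hd using hd
  let I := {v : V // ∀ w, ¬ M.Adj v w}
  let L : (LinearMap.ker P.faceCoboundary × (I → ZMod 2)) →ₗ[ZMod 2] (V → ZMod 2) :=
    { toFun := fun x v => if h : ∀ w, ¬ M.Adj v w then x.2 ⟨v, h⟩ else x.1.1 (P.face (d v h))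
      map_add' := by
        intro x y; ext v
        by_cases h : ∀ w, ¬ M.Adj v w <;> simp [h]
      map_smul' := by
        intro c x; ext v
        by_cases h : ∀ w, ¬ M.Adj v w <;> simp [h] }
  have hL : ∀ x (e : M.Dart), L x e.fst = x.1.1 (P.face e) := by
    intro x e
    have h : ¬ ∀ w, ¬ M.Adj e.fst w := fun h => h _ e.adj
    change (if h : _ then _ else _) = _
    rw [dif_neg h]
    exact hconst _ x.1.2 _ _ (hd _ h)
  have hmem : ∀ x, L x ∈ LinearMap.ker (incidence M).transpose.mulVecLin := by
    intro x
    rw [LinearMap.mem_ker, Matrix.mulVecLin_apply]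
    ext e
    obtain ⟨e', he⟩ := exists_dart_edge e
    obtain rfl : e = ⟨e'.edge, e'.edge_mem⟩ := Subtype.ext he.symm
    have := congrFun (LinearMap.mem_ker.1 x.1.2) ⟨e'.edge, e'.edge_mem⟩
    rw [faceCoboundary_apply] at this
    rw [incidence_transpose_mulVec, hL x e', show e'.snd = e'.symm.fst from rfl, hL x e'.symm]
    exact this
  have hinj : Function.Injective (L.codRestrict _ hmem) := by
    rw [← LinearMap.ker_eq_bot, LinearMap.ker_eq_bot']
    intro x hx
    have hx' : L x = 0 := congrArg Subtype.val hx
    refine Prod.ext (Subtype.ext (funext fun F => ?_)) (funext fun v => ?_)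
    · obtain ⟨e, rfl⟩ := Quotient.exists_rep F
      exact (hL x e).symm.trans (congrFun hx' _)
    · have := congrFun hx' v.1
      change (if h : _ then _ else _) = _ at this
      rwa [dif_pos v.2] at this
  have := LinearMap.finrank_le_finrank_of_injective hinj
  rw [Module.finrank_prod, Module.finrank_fintype_fun_eq_card] at this
  rwa [Nat.card_eq_fintype_card]

/-- In genus zero, every cycle bounds: Euler's formula forces the space of coboundaries to have the
dimension of the cycle space. -/
theorem range_faceCoboundary [Fintype M.edgeSet] [Fintype V] :
    LinearMap.range P.faceCoboundary = LinearMap.ker (incidence M).mulVecLin := by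
  classical
  have := Fintype.ofFinite P.Face
  refine Submodule.eq_of_le_of_finrank_le P.range_faceCoboundary_le ?_
  have h1 := LinearMap.finrank_range_add_finrank_ker P.faceCoboundary
  have h2 := LinearMap.finrank_range_add_finrank_ker (incidence M).mulVecLin
  have h3 := LinearMap.finrank_range_add_finrank_ker (incidence M).transpose.mulVecLin
  have h4 : Module.finrank (ZMod 2) (LinearMap.range (incidence M).transpose.mulVecLin) =
    Module.finrank (ZMod 2) (LinearMap.range (incidence M).mulVecLin) :=
      Matrix.rank_transpose (incidence M)
  have h5 := P.finrank_ker_faceCoboundary_add_le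
  have h6 := finrank_ker_incidence_transpose_le (M := M)
  have h7 := P.euler
  have h8 : Nat.card (Quotient (Equiv.Perm.SameCycle.setoid
    (P.next * Function.Involutive.toPerm _ (SimpleGraph.Dart.symm_involutive (G := M))))) =
      Fintype.card P.Face := Nat.card_eq_fintype_card (α := P.Face)
  rw [Module.finrank_fintype_fun_eq_card] at h1 h2 h3
  rw [Nat.card_eq_fintype_card, Nat.card_eq_fintype_card (α := M.edgeSet), h8] at h7
  omega

end Winding

end PlaneEmbedding

/-! ### Winding functions and separation -/

namespace PlaneEmbedding

section Separation

variable {V : Type*} [Finite V] [DecidableEq V] {M : SimpleGraph V} (P : PlaneEmbedding M)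

/-- A winding function (modulo two) of a list `L` of edges: a function on the faces that changes
precisely at the edges that occur an odd number of times in `L`. -/
def IsWinding (L : List (Sym2 V)) (W : P.Face → ZMod 2) : Prop :=
  ∀ d : M.Dart, W (P.face d) + W (P.face d.symm) = (L.count d.edge : ZMod 2)

omit [Finite V] in
/-- The boundary of a walk is the sum of its ends. -/
theorem incidence_mulVec_count_edges [Fintype M.edgeSet] {u v : V} (w : M.Walk u v) :
    (incidence M).mulVec (fun e => (w.edges.count (e : Sym2 V) : ZMod 2)) =
      Pi.single u 1 + Pi.single v 1 := by
  induction w with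
  | nil =>
    rw [show (Pi.single _ 1 + Pi.single _ 1 : V → ZMod 2) = 0 from
      funext fun _ => CharTwo.add_self_eq_zero _]
    exact Matrix.mulVec_zero _
  | @cons u v w h p ih =>
    have h1 : (fun e : M.edgeSet => ((p.cons h).edges.count (e : Sym2 V) : ZMod 2)) =
        Pi.single ⟨s(u, v), h⟩ 1 + fun e : M.edgeSet => (p.edges.count (e : Sym2 V) : ZMod 2) := by
      ext e
      simp only [SimpleGraph.Walk.edges_cons, List.count_cons, Pi.add_apply, Pi.single_apply,
        Subtype.ext_iff, beq_iff_eq, eq_comm (a := s(u, v))]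
      push_cast
      rw [add_comm]
    rw [h1, Matrix.mulVec_add, ih, Matrix.mulVec_single_one]
    ext x
    have hne := h.ne
    simp only [incidence, Pi.add_apply, Matrix.col_apply, Matrix.of_apply, Sym2.mem_iff,
      Pi.single_apply]
    by_cases h2 : x = u
    · subst h2; simp [hne]
    · by_cases h3 : x = v
      · subst h3; simp [h2, ← add_assoc, CharTwo.add_self_eq_zero]
      · simp [h2, h3]

theorem exists_isWinding_edges {u : V} (c : M.Walk u u) : ∃ W, P.IsWinding c.edges W := by
  have := Fintype.ofFinite V
  have := Fintype.ofFinite M.edgeSet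
  have h : (fun e : M.edgeSet => (c.edges.count (e : Sym2 V) : ZMod 2)) ∈
      LinearMap.range P.faceCoboundary := by
    rw [range_faceCoboundary, LinearMap.mem_ker, Matrix.mulVecLin_apply,
      incidence_mulVec_count_edges]
    exact funext fun _ => CharTwo.add_self_eq_zero _
  obtain ⟨W, hW⟩ := h
  refine ⟨W, fun d => ?_⟩
  rw [← P.faceCoboundary_apply, hW]

namespace IsWinding

variable {P} {L L' : List (Sym2 V)} {W W' : P.Face → ZMod 2}

theorem append (h : P.IsWinding L W) (h' : P.IsWinding L' W') :
    P.IsWinding (L ++ L') (W + W') := by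
  intro d
  rw [List.count_append, Nat.cast_add, ← h d, ← h' d, Pi.add_apply, Pi.add_apply]
  ring

theorem congr (h : P.IsWinding L W) (hL : ∀ e, Even ((L ++ L').count e)) :
    P.IsWinding L' W := by
  intro d
  rw [h d]
  have := (ZMod.natCast_eq_zero_iff_even).2 (hL d.edge)
  rw [List.count_append, Nat.cast_add] at this
  exact CharTwo.add_eq_zero.1 this

theorem face_symm (h : P.IsWinding L W) {d : M.Dart} (hd : d.edge ∉ L) :
    W (P.face d.symm) = W (P.face d) := by
  have := h d
  rw [List.count_eq_zero_of_not_mem hd, Nat.cast_zero] at this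
  exact (CharTwo.add_eq_zero.1 this).symm

theorem face_next (h : P.IsWinding L W) (d : M.Dart) :
    W (P.face (P.next d)) = W (P.face d) + (L.count d.edge : ZMod 2) := by
  rw [P.face_next, ← h d, ← add_assoc, CharTwo.add_self_eq_zero, zero_add]

/-- Turning around a vertex, the winding number changes at the darts of the list. -/
theorem face_next_pow (h : P.IsWinding L W) (d : M.Dart) (n : ℕ) :
    W (P.face ((P.next ^ n) d)) =
      W (P.face d) + ∑ i ∈ Finset.range n, (L.count ((P.next ^ i) d).edge : ZMod 2) := by
  induction n with
  | zero => simp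
  | succ n ih =>
    rw [pow_succ', Equiv.Perm.mul_apply, h.face_next, ih, Finset.sum_range_succ, add_assoc]

/-- A winding function has the same value at all corners of a vertex off the edges. -/
theorem face_eq_of_fst_eq (h : P.IsWinding L W) {d d' : M.Dart} (hL : ∀ e ∈ L, d.fst ∉ e)
    (hd : d'.fst = d.fst) : W (P.face d') = W (P.face d) := by
  obtain ⟨n, rfl⟩ := ((P.sameCycle_iff d d').2 hd.symm).exists_nat_pow_eq
  have hn : ∀ n, ((P.next ^ n) d).fst = d.fst := fun n =>
    ((P.sameCycle_iff d _).1 ⟨n, by simp⟩).symm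
  rw [h.face_next_pow, Finset.sum_eq_zero, add_zero]
  intro i _
  rw [List.count_eq_zero_of_not_mem, Nat.cast_zero]
  intro hm
  exact hL _ hm (hn i ▸ Sym2.mem_mk_left _ _)

/-- A winding function is constant along a walk off the edges. -/
theorem face_eq_of_walk (h : P.IsWinding L W) {u v : V} (w : M.Walk u v)
    (hw : ∀ x ∈ w.support, ∀ e ∈ L, x ∉ e) {d d' : M.Dart} (hd : d.fst = u) (hd' : d'.fst = v) :
    W (P.face d) = W (P.face d') := by
  induction w generalizing d with
  | nil => exact h.face_eq_of_fst_eq (hd' ▸ hw _ (by simp)) (hd.trans hd'.symm)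
  | @cons u v w huv p ih =>
    let e : M.Dart := ⟨(u, v), huv⟩
    have hu := hw u (by simp)
    rw [h.face_eq_of_fst_eq (d := e) hu hd,
      ← h.face_symm (d := e) fun he => hu _ he (Sym2.mem_mk_left _ _)]
    exact ih (fun x hx => hw x (by simp [hx])) rfl hd'

/-- Two closed curves that leave a vertex `x` by darts `d₁`, `d₂` and return by the same dart `d₃`.
In the cyclic order at `x`, going from `d₃` to `d₂` one meets `d₁` if and only if going from `d₃` to
`d₁` one does not meet `d₂`. This determines the parity of the four winding numbers at these darts,
whatever the rotation at `x` is. -/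
theorem face_add_face_ne (h : P.IsWinding L W) (h' : P.IsWinding L' W') {d₁ d₂ d₃ : M.Dart}
    (h₁ : d₁.fst = d₃.fst) (h₂ : d₂.fst = d₃.fst) (h₁₂ : d₁ ≠ d₂) (h₁₃ : d₁ ≠ d₃) (h₂₃ : d₂ ≠ d₃)
    (hL : ∀ d : M.Dart, d.fst = d₃.fst →
      (L.count d.edge : ZMod 2) = if d = d₁ ∨ d = d₃ then 1 else 0)
    (hL' : ∀ d : M.Dart, d.fst = d₃.fst →
      (L'.count d.edge : ZMod 2) = if d = d₂ ∨ d = d₃ then 1 else 0) :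
    W (P.face d₂) + W' (P.face d₁) ≠ W (P.face d₃) + W' (P.face d₃) := by
  -- The darts at the vertex are the first `n` iterates of `d₃`, each occurring once.
  set n := Function.minimalPeriod P.next d₃ with hn
  have hper : ∀ d : M.Dart, d.fst = d₃.fst → d ≠ d₃ → ∃ i < n, 0 < i ∧ (P.next ^ i) d₃ = d := by
    intro d hd hne
    obtain ⟨i, rfl⟩ := ((P.sameCycle_iff d₃ d).2 hd.symm).exists_nat_pow_eq
    have hi : (P.next ^ (i % n)) d₃ = (P.next ^ i) d₃ := by
      rw [← Equiv.Perm.iterate_eq_pow, ← Equiv.Perm.iterate_eq_pow, hn,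
        Function.iterate_mod_minimalPeriod_eq]
    refine ⟨i % n, Nat.mod_lt _ ?_, Nat.pos_of_ne_zero fun h0 => hne ?_, hi⟩
    · obtain ⟨m, hm, hm'⟩ := (isOfFinOrder_of_finite P.next).exists_pow_eq_one
      refine Function.minimalPeriod_pos_of_mem_periodicPts ⟨m, hm, ?_⟩
      rw [Function.IsPeriodicPt, Function.IsFixedPt, Equiv.Perm.iterate_eq_pow, hm']
      rfl
    · rw [← hi, h0]; rfl
  have hinj : ∀ i < n, ∀ j < n, (P.next ^ i) d₃ = (P.next ^ j) d₃ → i = j := by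
    intro i hi j hj hij
    rw [← Equiv.Perm.iterate_eq_pow, ← Equiv.Perm.iterate_eq_pow] at hij
    exact Function.iterate_injOn_Iio_minimalPeriod hi hj hij
  obtain ⟨i, hi, hi0, hi'⟩ := hper d₁ h₁ h₁₃
  obtain ⟨j, hj, hj0, hj'⟩ := hper d₂ h₂ h₂₃
  have hij : i ≠ j := by rintro rfl; exact h₁₂ (hi'.symm.trans hj')
  -- From `d₃` to the `j`th dart, a curve through the `0`th and the `i`th dart is crossed at the
  -- former, and also at the latter if `i < j`.
  have key : ∀ (L : List (Sym2 V)) (W : P.Face → ZMod 2) (d : M.Dart) (i j : ℕ), i < n → j < n →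
      0 < i → 0 < j → (P.next ^ i) d₃ = d → P.IsWinding L W →
      (∀ d' : M.Dart, d'.fst = d₃.fst → (L.count d'.edge : ZMod 2) =
        if d' = d ∨ d' = d₃ then 1 else 0) →
      W (P.face ((P.next ^ j) d₃)) = W (P.face d₃) + (1 + if i < j then 1 else 0) := by
    intro L W d i j hi hj hi0 hj0 hid hW hL
    rw [hW.face_next_pow]
    congr 1
    have : ∀ l ∈ Finset.range j, (L.count ((P.next ^ l) d₃).edge : ZMod 2) =
        (if l = 0 then 1 else 0) + if l = i then 1 else 0 := by
      intro l hl
      have hl := (Finset.mem_range.1 hl).trans hj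
      rw [hL _ ((P.sameCycle_iff d₃ _).1 ⟨l, by simp⟩).symm]
      by_cases hl0 : l = 0
      · subst hl0; simp [hi0.ne]
      · by_cases hli : l = i
        · subst hli; simp [hid, hl0]
        · rw [if_neg, if_neg hl0, if_neg hli, add_zero]
          rintro (h | h)
          · exact hli (hinj _ hl _ hi (h.trans hid.symm))
          · exact hl0 (hinj _ hl 0 (by omega) h)
    rw [Finset.sum_congr rfl this, Finset.sum_add_distrib, Finset.sum_ite_eq', Finset.sum_ite_eq']
    simp [hj0]
  have e1 := key L W d₁ i j hi hj hi0 hj0 hi' h hL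
  have e2 := key L' W' d₂ j i hj hi hj0 hi0 hj' h' hL'
  rw [hj'] at e1
  rw [hi'] at e2
  rw [e1, e2]
  intro h0
  have h3 : ((1 + if i < j then 1 else 0) + (1 + if j < i then 1 else 0) : ZMod 2) = 0 := by
    linear_combination h0
  rcases lt_or_gt_of_ne hij with hlt | hlt
  · simp only [hlt, hlt.not_gt, if_true, if_false] at h3; exact absurd h3 (by decide)
  · simp only [hlt, hlt.not_gt, if_true, if_false] at h3; exact absurd h3 (by decide)

end IsWinding

/-- The list `C` of edges separates `a` from `b`: some winding function of `C` takes different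
values at the corners of `a` and at the corners of `b`. -/
def Separates (C : List (Sym2 V)) (a b : V) : Prop :=
  ∃ W, P.IsWinding C W ∧
    ∀ d d' : M.Dart, d.fst = a → d'.fst = b → W (P.face d) ≠ W (P.face d')

end Separation

end PlaneEmbedding

namespace SimpleGraph

/-- Edges and walks that force the list `C` of edges to separate `a` from `b` in every plane
embedding of `G`. Three edges lead from a vertex `x` to `x₁`, `x₂` and `x₃`. The closed walk `c₁`
runs through `x₁`, along `p₁` to `x₃` and back to `x`, the closed walk `c₂` likewise through `x₂`
and `p₂`, and `c` is a closed walk that may be trivial; modulo two, `C` is the sum of `c₁`, `c₂`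
and `c`. The walks `u₁`, `u₂`, `u₃` and `u₄` serve to compare winding numbers: with respect to
`c₂`, `c₁` and `c`, the vertex `b` is on the same side as the edge `x x₁`, the edge `x x₂` and the
vertex `x`, respectively, and with respect to `C`, the vertex `a` is on the same side as the edge
`x x₃`.

For example, let `G` be `K₃,₃` with the edge `ab` removed, `x` a neighbour of `a = x₃`, let `x₁`
and `x₂` be the neighbours of `b`, and let `p₁` and `p₂` pass through the other neighbour of `a`;
here `c` is trivial. If `G` is `K₅` with the edge `ab` removed, again with `a = x₃`, let `x`, `x₁`
and `x₂` be the three other vertices and `c` the triangle `x₁ x₂ x₃`.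

The conditions are decidable, and are checked by computation in concrete cases. -/
structure SeparatingConfiguration {V : Type*} [DecidableEq V] (G : SimpleGraph V)
    (C : List (Sym2 V)) (a b : V) where
  (x x₁ x₂ x₃ y : V)
  adj₁ : G.Adj x x₁ := by decide
  adj₂ : G.Adj x x₂ := by decide
  adj₃ : G.Adj x x₃ := by decide
  ne₁₂ : x₁ ≠ x₂ := by decide
  ne₁₃ : x₁ ≠ x₃ := by decide
  ne₂₃ : x₂ ≠ x₃ := by decide
  p₁ : G.Walk x₁ x₃
  p₂ : G.Walk x₂ x₃
  c : G.Walk y y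
  notMem₁ : x ∉ p₁.support := by decide
  notMem₂ : x ∉ p₂.support := by decide
  even_count : ∀ e,
    Even ((s(x, x₁) :: s(x, x₂) :: (p₁.edges ++ p₂.edges ++ c.edges) ++ C).count e) := by decide
  u₁ : G.Walk x₁ b
  u₂ : G.Walk x₂ b
  u₃ : G.Walk x b
  u₄ : G.Walk x₃ a
  avoids₁ : ∀ v ∈ u₁.support, v ≠ x ∧ v ∉ p₂.support := by decide
  avoids₂ : ∀ v ∈ u₂.support, v ≠ x ∧ v ∉ p₁.support := by decide
  avoids₃ : ∀ v ∈ u₃.support, ∀ e ∈ c.edges, v ∉ e := by decide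
  avoids₄ : ∀ v ∈ u₄.support, ∀ e ∈ C, v ∉ e := by decide

namespace SeparatingConfiguration

variable {V : Type*} [DecidableEq V] {M : SimpleGraph V} {C : List (Sym2 V)} {a b : V}

/-- The closed walk from `x` through `x₁`, along `p` to `x₃` and back passes precisely two edges at
`x`, each of them once. -/
theorem count_edges_cons_concat {x x₁ x₃ : V} (h₁ : M.Adj x x₁) (h₃ : M.Adj x x₃)
    (h₁₃ : x₁ ≠ x₃) (p : M.Walk x₁ x₃) (hp : x ∉ p.support) (d : M.Dart) (hd : d.fst = x) :
    ((SimpleGraph.Walk.cons h₁ (p.concat h₃.symm)).edges.count d.edge : ZMod 2) =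
      if d = ⟨(x, x₁), h₁⟩ ∨ d = ⟨(x, x₃), h₃⟩ then 1 else 0 := by
  obtain ⟨⟨u, v⟩, huv⟩ := d
  obtain rfl : u = x := hd
  have h0 : p.edges.count s(u, v) = 0 :=
    List.count_eq_zero_of_not_mem fun h => hp (p.fst_mem_support_of_mem_edges h)
  have hv : v ≠ u := (huv : M.Adj u v).ne.symm
  simp only [SimpleGraph.Walk.edges_cons, SimpleGraph.Walk.edges_concat, List.concat_eq_append,
    List.count_cons, List.count_append, List.count_nil, SimpleGraph.Dart.edge_mk, h0,
    SimpleGraph.Dart.ext_iff, Prod.mk.injEq, true_and, beq_iff_eq, Sym2.eq_iff]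
  by_cases h4 : v = x₁
  · subst h4; simp [h₁₃.symm, h₁₃, hv.symm]
  · by_cases h5 : v = x₃
    · subst h5; simp [h₁₃, hv.symm, hv]
    · simp [h4, h5, hv.symm, Ne.symm h4, Ne.symm h5]

variable [Finite V]

/-- With the winding functions `W₁`, `W₂`, `W₃` of the three closed walks and `W` their sum, `W` is
`W₁(d₂) + W₂(d₁) + W₃(d₃)` at `b` and `W₁(d₃) + W₂(d₃) + W₃(d₃)` at `a`. -/
theorem separates (S : SeparatingConfiguration M C a b) (P : PlaneEmbedding M) :
    P.Separates C a b := by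
  let c₁ : M.Walk S.x S.x := .cons S.adj₁ (S.p₁.concat S.adj₃.symm)
  let c₂ : M.Walk S.x S.x := .cons S.adj₂ (S.p₂.concat S.adj₃.symm)
  obtain ⟨W₁, h₁⟩ := P.exists_isWinding_edges c₁
  obtain ⟨W₂, h₂⟩ := P.exists_isWinding_edges c₂
  obtain ⟨W₃, h₃⟩ := P.exists_isWinding_edges S.c
  let d₁ : M.Dart := ⟨(S.x, S.x₁), S.adj₁⟩
  let d₂ : M.Dart := ⟨(S.x, S.x₂), S.adj₂⟩
  let d₃ : M.Dart := ⟨(S.x, S.x₃), S.adj₃⟩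
  have hW : P.IsWinding C (W₁ + W₂ + W₃) := by
    refine ((h₁.append h₂).append h₃).congr fun e => ?_
    have h := S.even_count e
    simp only [c₁, c₂, SimpleGraph.Walk.edges_cons, SimpleGraph.Walk.edges_concat,
      List.concat_eq_append, List.count_append, List.count_cons, List.count_nil,
      List.cons_append] at h ⊢
    grind
  -- A vertex other than `x` and off `p` is off the closed walk through `p`.
  have hc : ∀ (z : V) (h : M.Adj S.x z) (p : M.Walk z S.x₃) (v : V), v ≠ S.x → v ∉ p.support →
      ∀ e ∈ (SimpleGraph.Walk.cons h (p.concat S.adj₃.symm)).edges, v ∉ e := by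
    intro z h p v hv hp e he hve
    have := SimpleGraph.Walk.mem_support_of_mem_edges he hve
    simp [SimpleGraph.Walk.support_concat, hv, hp] at this
  refine ⟨_, hW, fun d d' hd hd' heq => ?_⟩
  have key := h₁.face_add_face_ne h₂ (d₁ := d₁) (d₂ := d₂) (d₃ := d₃) rfl rfl
    (by simpa [d₁, d₂, SimpleGraph.Dart.ext_iff] using S.ne₁₂)
    (by simpa [d₁, d₃, SimpleGraph.Dart.ext_iff] using S.ne₁₃)
    (by simpa [d₂, d₃, SimpleGraph.Dart.ext_iff] using S.ne₂₃)
    (fun d hd => count_edges_cons_concat S.adj₁ S.adj₃ S.ne₁₃ S.p₁ S.notMem₁ d hd)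
    (fun d hd => count_edges_cons_concat S.adj₂ S.adj₃ S.ne₂₃ S.p₂ S.notMem₂ d hd)
  have e₂ : W₁ (P.face d₂) = W₁ (P.face d') := by
    have hoff : ∀ v ∈ S.u₂.support, ∀ e ∈ c₁.edges, v ∉ e := fun v hv =>
      hc _ S.adj₁ S.p₁ v (S.avoids₂ v hv).1 (S.avoids₂ v hv).2
    rw [← h₁.face_symm (d := d₂) fun h => hoff _ S.u₂.start_mem_support _ h (Sym2.mem_mk_right _ _)]
    exact h₁.face_eq_of_walk S.u₂ hoff rfl hd'
  have e₁ : W₂ (P.face d₁) = W₂ (P.face d') := by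
    have hoff : ∀ v ∈ S.u₁.support, ∀ e ∈ c₂.edges, v ∉ e := fun v hv =>
      hc _ S.adj₂ S.p₂ v (S.avoids₁ v hv).1 (S.avoids₁ v hv).2
    rw [← h₂.face_symm (d := d₁) fun h => hoff _ S.u₁.start_mem_support _ h (Sym2.mem_mk_right _ _)]
    exact h₂.face_eq_of_walk S.u₁ hoff rfl hd'
  have e₃ : W₃ (P.face d₃) = W₃ (P.face d') := h₃.face_eq_of_walk S.u₃ S.avoids₃ rfl hd'
  have e₄ : (W₁ + W₂ + W₃) (P.face d₃) = (W₁ + W₂ + W₃) (P.face d) := by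
    rw [← hW.face_symm (d := d₃) fun h =>
      S.avoids₄ _ S.u₄.start_mem_support _ h (Sym2.mem_mk_right _ _)]
    exact hW.face_eq_of_walk S.u₄ S.avoids₄ rfl hd
  apply key
  rw [← e₄] at heq
  simp only [Pi.add_apply] at heq
  rw [e₂, e₁]
  linear_combination -heq + e₃

/-- A graph in which some list of edges would separate a vertex from itself is not planar. -/
theorem not_isPlanar (S : SeparatingConfiguration M C a a) : ¬ IsPlanar M := by
  rintro ⟨P⟩
  obtain ⟨W, -, h⟩ := S.separates P
  have hd : ∀ {z : V} (w : M.Walk z S.x₃), ∃ d : M.Dart, d.fst = z := by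
    rintro z (_ | ⟨h', _⟩)
    · exact ⟨⟨(_, _), S.adj₃.symm⟩, rfl⟩
    · exact ⟨⟨(_, _), h'⟩, rfl⟩
  obtain ⟨d, hd⟩ := hd S.u₄.reverse
  exact h d d hd hd rfl

omit [Finite V] in
theorem even_count_map {W : Type*} [DecidableEq W] {f : V → W} (hf : Function.Injective f)
    {L : List (Sym2 V)} (hL : ∀ e, Even (L.count e)) (e : Sym2 W) :
    Even ((L.map (Sym2.map f)).count e) := by
  by_cases he : e ∈ L.map (Sym2.map f)
  · obtain ⟨e, -, rfl⟩ := List.mem_map.1 he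
    rw [List.count_map_of_injective _ _ (Sym2.map.injective hf)]
    exact hL e
  · simp [List.count_eq_zero_of_not_mem he]

omit [Finite V] [DecidableEq V] in
theorem forall_notMem_map {W : Type*} {f : V → W} (hf : Function.Injective f)
    {L : List (Sym2 V)} {l : List V} (h : ∀ v ∈ l, ∀ e ∈ L, v ∉ e) :
    ∀ v ∈ l.map f, ∀ e ∈ L.map (Sym2.map f), v ∉ e := by
  intro _ hv _ he hve
  obtain ⟨v, hvl, rfl⟩ := List.mem_map.1 hv
  obtain ⟨e, heL, rfl⟩ := List.mem_map.1 he
  obtain ⟨v', hv', h'⟩ := Sym2.mem_map.1 hve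
  exact h v hvl e heL (hf h' ▸ hv')

omit [Finite V] in
/-- A separating configuration is carried along by injective homomorphisms. -/
def map {W : Type*} [DecidableEq W] {N : SimpleGraph W} (S : SeparatingConfiguration M C a b)
    (f : M →g N) (hf : Function.Injective f) :
    SeparatingConfiguration N (C.map (Sym2.map f)) (f a) (f b) where
  x := f S.x
  x₁ := f S.x₁
  x₂ := f S.x₂
  x₃ := f S.x₃
  y := f S.y
  adj₁ := f.map_adj S.adj₁
  adj₂ := f.map_adj S.adj₂
  adj₃ := f.map_adj S.adj₃
  ne₁₂ := hf.ne S.ne₁₂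
  ne₁₃ := hf.ne S.ne₁₃
  ne₂₃ := hf.ne S.ne₂₃
  p₁ := S.p₁.map f
  p₂ := S.p₂.map f
  c := S.c.map f
  notMem₁ := by simpa [hf.eq_iff] using S.notMem₁
  notMem₂ := by simpa [hf.eq_iff] using S.notMem₂
  even_count := by simpa using even_count_map hf S.even_count
  u₁ := S.u₁.map f
  u₂ := S.u₂.map f
  u₃ := S.u₃.map f
  u₄ := S.u₄.map f
  avoids₁ := by
    simp only [SimpleGraph.Walk.support_map, List.forall_mem_map, List.mem_map_of_injective hf]
    exact fun v hv => ⟨hf.ne (S.avoids₁ v hv).1, (S.avoids₁ v hv).2⟩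
  avoids₂ := by
    simp only [SimpleGraph.Walk.support_map, List.forall_mem_map, List.mem_map_of_injective hf]
    exact fun v hv => ⟨hf.ne (S.avoids₂ v hv).1, (S.avoids₂ v hv).2⟩
  avoids₃ := by
    rw [SimpleGraph.Walk.support_map, SimpleGraph.Walk.edges_map]
    exact forall_notMem_map hf S.avoids₃
  avoids₄ := by
    rw [SimpleGraph.Walk.support_map]
    exact forall_notMem_map hf S.avoids₄

end SeparatingConfiguration

end SimpleGraph

/-! ### Strong conflicts and strong anti-conflicts -/

namespace SimpleGraph

variable {V : Type*}

/-- Two pairs of disjoint paths that join the ends of two edges `ab` and `cd`, such that the two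
paths for `cd` together separate `a` from `b`. -/
structure ConflictConfiguration [DecidableEq V] (G : SimpleGraph V) (a b c d : V) where
  (p p' : G.Walk b a)
  (q q' : G.Walk d c)
  nodup_p : p.support.Nodup := by decide
  nodup_p' : p'.support.Nodup := by decide
  nodup_q : q.support.Nodup := by decide
  nodup_q' : q'.support.Nodup := by decide
  disjoint : ∀ v ∈ p.support, v ∉ q.support := by decide
  disjoint' : ∀ v ∈ p'.support, v ∉ q'.support := by decide
  separating : SeparatingConfiguration G (q.edges ++ q'.edges) a b

/-- A cycle `q` of `G` that is disjoint from a cycle composed of the edge `ab`, a path `p` in `G`,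
the edge `cd` and a path `p'` in `G`. (As `G` is a simple graph, a closed walk that repeats no edge
and no vertex but the first is a cycle.) -/
structure AvoidingCycle (G : SimpleGraph V) (a b c d : V) where
  x : V
  q : G.Walk x x
  p : G.Walk b c
  p' : G.Walk d a
  length_q : 0 < q.length := by decide
  nodup_edges : q.edges.Nodup := by decide
  nodup_tail : q.support.tail.Nodup := by decide
  nodup_p : p.support.Nodup := by decide
  nodup_p' : p'.support.Nodup := by decide
  disjoint : ∀ v ∈ p.support, v ∉ p'.support := by decide
  disjoint_p : ∀ v ∈ q.support, v ∉ p.support := by decide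
  disjoint_p' : ∀ v ∈ q.support, v ∉ p'.support := by decide

theorem AvoidingCycle.isCycle {G : SimpleGraph V} {a b c d : V} (q : AvoidingCycle G a b c d) :
    q.q.IsCycle := by
  rw [Walk.isCycle_def]
  refine ⟨⟨q.nodup_edges⟩, fun h => ?_, q.nodup_tail⟩
  have := q.length_q
  rw [h] at this
  exact absurd this (lt_irrefl 0)

theorem disjoint_support_map {W : Type*} {G : SimpleGraph V} {H : SimpleGraph W} (f : G →g H)
    (hf : Function.Injective f) {a b c d : V} {p : G.Walk a b} {q : G.Walk c d}
    (h : ∀ v ∈ p.support, v ∉ q.support) : ∀ v ∈ (p.map f).support, v ∉ (q.map f).support := by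
  simp only [Walk.support_map, List.forall_mem_map, List.mem_map_of_injective hf]
  exact h

theorem nodup_support_map {W : Type*} {G : SimpleGraph V} {H : SimpleGraph W} (f : G →g H)
    (hf : Function.Injective f) {a b : V} {p : G.Walk a b} (h : p.support.Nodup) :
    (p.map f).support.Nodup := by
  rw [Walk.support_map]
  exact h.map hf

/-- An avoiding cycle is carried along by injective homomorphisms. -/
def AvoidingCycle.map {W : Type*} {G : SimpleGraph V} {H : SimpleGraph W} {a b c d : V}
    (q : AvoidingCycle G a b c d) (f : G →g H) (hf : Function.Injective f) :
    AvoidingCycle H (f a) (f b) (f c) (f d) where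
  x := f q.x
  q := q.q.map f
  p := q.p.map f
  p' := q.p'.map f
  length_q := by simpa using q.length_q
  nodup_edges := (q.isCycle.map hf).edges_nodup
  nodup_tail := (q.isCycle.map hf).support_nodup
  nodup_p := nodup_support_map f hf q.nodup_p
  nodup_p' := nodup_support_map f hf q.nodup_p'
  disjoint := disjoint_support_map f hf q.disjoint
  disjoint_p := disjoint_support_map f hf q.disjoint_p
  disjoint_p' := disjoint_support_map f hf q.disjoint_p'

/-- Cycles disjoint from a cycle through `ab` and `cd`, which together separate `a` from `b`. -/
structure AntiConflictConfiguration [DecidableEq V] (G : SimpleGraph V) (a b c d : V) where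
  Q : List (AvoidingCycle G a b c d)
  separating : SeparatingConfiguration G (Q.flatMap fun q => q.q.edges) a b

end SimpleGraph

namespace PlaneEmbedding

open SimpleGraph (AvoidingCycle)

section Conflict

variable {V : Type*} [Finite V] [DecidableEq V] {M : SimpleGraph V} {P : PlaneEmbedding M}

/-- The number of crossings of a curve with a list of darts is, modulo two, the difference of the
winding numbers at its ends. -/
theorem IsWinding.sum_crossings {L : List (Sym2 V)} {W : P.Face → ZMod 2} (h : P.IsWinding L W)
    {D : List M.Dart} (hD : D.map SimpleGraph.Dart.edge = L) {F F' : P.Face} (c : Curve P F F') :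
    (((D.map c.crossings).sum : ℤ) : ZMod 2) = W F + W F' := by
  classical
  induction c with
  | nil F => simp [Curve.crossings, CharTwo.add_self_eq_zero]
  | @cross d F' c ih =>
    have h1 : ∀ D : List M.Dart, (((D.map (Curve.cross d c).crossings).sum : ℤ) : ZMod 2) =
        ((D.map SimpleGraph.Dart.edge).count d.edge : ZMod 2) +
          (((D.map c.crossings).sum : ℤ) : ZMod 2) := by
      intro D
      induction D with
      | nil => simp
      | cons x D ihD =>
        have hx : (Curve.cross d c).crossings x =
            (if x = d then 1 else 0) - (if x = d.symm then 1 else 0) + c.crossings x := by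
          rw [Curve.crossings]; congr
        rw [List.map_cons, List.sum_cons, Int.cast_add, ihD, hx]
        simp only [List.map_cons, List.sum_cons, Int.cast_add, List.count_cons, beq_iff_eq,
          SimpleGraph.dart_edge_eq_iff]
        have hne := d.symm_ne
        by_cases hx : x = d
        · subst hx; simp [hne.symm]; ring
        · by_cases hx' : x = d.symm
          · subst hx'; simp [hne]; ring
          · simp [hx, hx']; ring
    rw [h1, ih, hD, ← h d, add_assoc, ← add_assoc (W (P.face d.symm)), CharTwo.add_self_eq_zero,
      zero_add]

/-- An arc that joins two separated vertices crosses the separating edges an odd number of times. -/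
theorem Separates.sum_crossings {a b : V} {D : List M.Dart}
    (h : P.Separates (D.map SimpleGraph.Dart.edge) a b) (A : P.Arc a b) :
    (((D.map A.curve.crossings).sum : ℤ) : ZMod 2) ≠ 0 := by
  obtain ⟨W, hW, hab⟩ := h
  rw [hW.sum_crossings rfl]
  exact fun h0 => hab _ _ A.start_fst A.finish_fst (CharTwo.add_eq_zero.1 h0)

theorem Separates.symm {a b : V} {C : List (Sym2 V)} (h : P.Separates C a b) :
    P.Separates C b a := by
  obtain ⟨W, hW, hab⟩ := h
  exact ⟨W, hW, fun d d' hd hd' => (hab d' d hd' hd).symm⟩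

/-- If `q` and `q'` together separate the ends of `e`, then any arc for `e` crosses one of them an
odd number of times more than the other, so that not both linking numbers vanish. -/
theorem stronglyConflict_of_separates {a b c d : V} {p p' : M.Walk b a} {q q' : M.Walk d c}
    (hp : p.IsPath) (hp' : p'.IsPath) (hq : q.IsPath) (hq' : q'.IsPath)
    (h : p.support.Disjoint q.support) (h' : p'.support.Disjoint q'.support)
    (hs : P.Separates (q.edges ++ q'.edges) a b) : P.StronglyConflict s(a, b) s(c, d) := by
  have key : ∀ {a b c d : V} {p p' : M.Walk b a} {q q' : M.Walk d c},
      p.IsPath → p'.IsPath → q.IsPath → q'.IsPath →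
      p.support.Disjoint q.support → p'.support.Disjoint q'.support →
      P.Separates (q.edges ++ q'.edges) a b → ∀ (A : P.Arc a b) (n : ℤ),
      ∃ (p : M.Walk b a) (q : M.Walk d c), p.IsPath ∧ q.IsPath ∧ p.support.Disjoint q.support ∧
        n + A.inter q ≠ 0 := by
    intro a b c d p p' q q' hp hp' hq hq' h h' hs A n
    by_contra! hcon
    have h1 := hcon p q hp hq h
    have h2 := hcon p' q' hp' hq' h'
    rw [SimpleGraph.Walk.edges, SimpleGraph.Walk.edges, ← List.map_append] at hs
    apply hs.sum_crossings A
    rw [List.map_append, List.sum_append]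
    have h3 : (q.darts.map A.curve.crossings).sum = -n := by
      have : A.inter q = (q.darts.map A.curve.crossings).sum := rfl
      omega
    have h4 : (q'.darts.map A.curve.crossings).sum = -n := by
      have : A.inter q' = (q'.darts.map A.curve.crossings).sum := rfl
      omega
    rw [h3, h4, Int.cast_add]
    exact CharTwo.add_self_eq_zero _
  -- The condition is symmetric in the ends of each of the two edges.
  have hrev : P.Separates (q.reverse.edges ++ q'.reverse.edges) a b := by
    obtain ⟨W, hW, hab⟩ := hs
    refine ⟨W, hW.congr fun e => ?_, hab⟩
    simp only [List.count_append, SimpleGraph.Walk.edges_reverse, List.count_reverse]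
    exact ⟨_, rfl⟩
  intro a' b' c' d' he hf A n
  rcases Sym2.eq_iff.1 he with ⟨rfl, rfl⟩ | ⟨rfl, rfl⟩ <;>
    rcases Sym2.eq_iff.1 hf with ⟨rfl, rfl⟩ | ⟨rfl, rfl⟩
  · exact key hp hp' hq hq' h h' hs A n
  · exact key hp hp' hq.reverse hq'.reverse (by simpa using h) (by simpa using h') hrev A n
  · exact key hp.reverse hp'.reverse hq hq' (by simpa using h) (by simpa using h') hs.symm A n
  · exact key hp.reverse hp'.reverse hq.reverse hq'.reverse (by simpa using h) (by simpa using h')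
      hrev.symm A n

/-- If the cycles in `Q` together separate the ends of `e`, then any arc for `e` crosses one of
them an odd number of times. Which one may depend on the embedding. -/
theorem stronglyAntiConflict_of_separates {a b c d : V} (Q : List (AvoidingCycle M a b c d))
    (hs : P.Separates (Q.flatMap fun q => q.q.edges) a b) :
    P.StronglyAntiConflict s(a, b) s(c, d) := by
  have key : ∀ {a' b' : V}, P.Separates (Q.flatMap fun q => q.q.edges) a' b' →
      ∀ A : P.Arc a' b', ∃ q ∈ Q, A.inter q.q ≠ 0 := by
    intro a' b' hs A
    by_contra! hcon
    have h1 : (Q.flatMap fun q => q.q.edges) =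
        (Q.flatMap fun q => q.q.darts).map SimpleGraph.Dart.edge := by
      rw [List.map_flatMap]; rfl
    rw [h1] at hs
    apply hs.sum_crossings A
    have h2 : ∀ Q : List (AvoidingCycle M a b c d), (∀ q ∈ Q, A.inter q.q = 0) →
        ((Q.flatMap fun q => q.q.darts).map A.curve.crossings).sum = 0 := by
      intro Q hcon
      induction Q with
      | nil => simp
      | cons q Q ih =>
        rw [List.flatMap_cons, List.map_append, List.sum_append,
          ih fun q hq => hcon q (List.mem_cons_of_mem _ hq), add_zero]
        exact hcon q List.mem_cons_self
    rw [h2 Q hcon, Int.cast_zero]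
  intro a' b' he A
  rcases Sym2.eq_iff.1 he with ⟨rfl, rfl⟩ | ⟨rfl, rfl⟩
  · obtain ⟨q, hq, h⟩ := key hs A
    exact ⟨c, d, q.p, q.p', q.x, q.q, rfl, .mk' q.nodup_p, .mk' q.nodup_p', q.isCycle,
      q.disjoint, q.disjoint_p, q.disjoint_p', h⟩
  · obtain ⟨q, hq, h⟩ := key hs.symm A
    refine ⟨d, c, q.p'.reverse, q.p.reverse, q.x, q.q, Sym2.eq_swap,
      (SimpleGraph.Walk.IsPath.mk' q.nodup_p').reverse,
      (SimpleGraph.Walk.IsPath.mk' q.nodup_p).reverse, q.isCycle, ?_⟩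
    simp only [SimpleGraph.Walk.support_reverse, List.disjoint_reverse_left,
      List.disjoint_reverse_right]
    exact ⟨List.Disjoint.symm q.disjoint, q.disjoint_p', q.disjoint_p, h⟩

end Conflict

end PlaneEmbedding

namespace SimpleGraph

variable {V : Type*} [DecidableEq V] {G : SimpleGraph V} {a b c d : V} {W : Type*} [Finite W]
  [DecidableEq W] {M : SimpleGraph W} (P : PlaneEmbedding M) (f : G →g M)

theorem ConflictConfiguration.stronglyConflict (S : ConflictConfiguration G a b c d)
    (hf : Function.Injective f) {e e' : Sym2 V} (he : s(a, b) = e := by decide)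
    (he' : s(c, d) = e' := by decide) : P.StronglyConflict (e.map f) (e'.map f) := by
  subst he he'
  exact PlaneEmbedding.stronglyConflict_of_separates
    (.mk' (nodup_support_map f hf S.nodup_p)) (.mk' (nodup_support_map f hf S.nodup_p'))
    (.mk' (nodup_support_map f hf S.nodup_q)) (.mk' (nodup_support_map f hf S.nodup_q'))
    (disjoint_support_map f hf S.disjoint) (disjoint_support_map f hf S.disjoint')
    (by simpa only [Walk.edges_map, List.map_append] using (S.separating.map f hf).separates P)

theorem AntiConflictConfiguration.stronglyAntiConflict (S : AntiConflictConfiguration G a b c d)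
    (hf : Function.Injective f) {e e' : Sym2 V} (he : s(a, b) = e := by decide)
    (he' : s(c, d) = e' := by decide) : P.StronglyAntiConflict (e.map f) (e'.map f) := by
  subst he he'
  refine PlaneEmbedding.stronglyAntiConflict_of_separates (S.Q.map fun q => q.map f hf) ?_
  have h := (S.separating.map f hf).separates P
  simpa only [List.map_flatMap, List.flatMap_map, AvoidingCycle.map, Walk.edges_map] using h

end SimpleGraph

/-! ### Transport and computation of plane embeddings -/

open SimpleGraph

namespace PlaneEmbedding

section Iso

variable {V W : Type*} {G : SimpleGraph V} {H : SimpleGraph W}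

/-- The bijection between darts induced by an isomorphism of graphs. -/
def dartEquiv (φ : G ≃g H) : G.Dart ≃ H.Dart where
  toFun := φ.toHom.mapDart
  invFun := φ.symm.toHom.mapDart
  left_inv d := by ext <;> simp [Hom.mapDart]
  right_inv d := by ext <;> simp [Hom.mapDart]

theorem sameCycle_permCongr {α β : Type*} (e : α ≃ β) (f : Equiv.Perm α) (x y : α) :
    (e.permCongr f).SameCycle (e x) (e y) ↔ f.SameCycle x y := by
  have h : ∀ n : ℤ, (e.permCongr f ^ n) (e x) = e ((f ^ n) x) := by
    intro n
    have : e.permCongr f ^ n = e.permCongr (f ^ n) := (map_zpow e.permCongrHom f n).symm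
    rw [this, Equiv.permCongr_apply, Equiv.symm_apply_apply]
  simp only [Equiv.Perm.SameCycle, h, e.apply_eq_iff_eq]

theorem card_sameCycle_permCongr {α β : Type*} (e : α ≃ β) (f : Equiv.Perm α) :
    Nat.card (Quotient (Equiv.Perm.SameCycle.setoid (e.permCongr f))) =
      Nat.card (Quotient (Equiv.Perm.SameCycle.setoid f)) :=
  Nat.card_congr (Quotient.congr e fun x y => (sameCycle_permCongr e f x y).symm).symm

/-- Plane embeddings are carried along by isomorphisms of graphs. -/
def ofIso [Finite V] [Finite W] (P : PlaneEmbedding G) (φ : G ≃g H) : PlaneEmbedding H where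
  next := (dartEquiv φ).permCongr P.next
  sameCycle_iff d d' := by
    obtain ⟨d, rfl⟩ := (dartEquiv φ).surjective d
    obtain ⟨d', rfl⟩ := (dartEquiv φ).surjective d'
    rw [sameCycle_permCongr, P.sameCycle_iff]
    exact φ.injective.eq_iff.symm
  euler := by
    have h1 : (dartEquiv φ).permCongr P.next *
        Function.Involutive.toPerm _ (Dart.symm_involutive (G := H)) =
        (dartEquiv φ).permCongr
          (P.next * Function.Involutive.toPerm _ (Dart.symm_involutive (G := G))) := by
      ext1 d
      rfl
    have h2 : Nat.card {v : W // ∀ w, ¬ H.Adj v w} = Nat.card {v : V // ∀ w, ¬ G.Adj v w} :=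
      Nat.card_congr (φ.toEquiv.subtypeEquiv fun v =>
        ⟨fun h w hw => h (φ.symm w) (φ.map_adj_iff.1 (by simpa using hw)),
          fun h w hw => h (φ w) (φ.map_adj_iff.2 hw)⟩).symm
    rw [h1, card_sameCycle_permCongr, h2, ← Nat.card_congr φ.toEquiv,
      ← Nat.card_congr φ.mapEdgeSet, ← Nat.card_congr φ.connectedComponentEquiv]
    exact P.euler

end Iso

section Rotation

variable {n : ℕ} {G : SimpleGraph (Fin (n + 1))}

/-- The permutation of the darts that is given by permutations of the neighbours. -/
def rotate (σ : Fin (n + 1) → Equiv.Perm (Fin (n + 1)))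
    (hσ : ∀ v w, G.Adj v (σ v w) ↔ G.Adj v w) : Equiv.Perm G.Dart where
  toFun d := ⟨(d.fst, σ d.fst d.snd), (hσ _ _).2 d.adj⟩
  invFun d := ⟨(d.fst, (σ d.fst).symm d.snd), (hσ _ _).1 (by simp)⟩
  left_inv d := by ext <;> simp
  right_inv d := by ext <;> simp

theorem connected_of_exists_lt (h : ∀ v : Fin (n + 1), v ≠ 0 → ∃ w < v, G.Adj v w) :
    G.Connected := by
  have : ∀ v : Fin (n + 1), G.Reachable v 0 := by
    intro v
    induction v using WellFoundedLT.induction with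
    | ind v ih =>
      by_cases hv : v = 0
      · rw [hv]
      · obtain ⟨w, hw, hvw⟩ := h v hv
        exact hvw.reachable.trans (ih w hw)
  exact ⟨fun u v => (this u).trans (this v).symm⟩

/-- A criterion for planarity that can be checked by computation: `σ v` permutes the neighbours of
`v` cyclically, and `face` is a numbering of the faces of the rotation system `σ`, in which `(v,
w)` stands for the dart from `v` to `w`. The bound `k` limits the lengths of all these cycles, and
`hconn` implies that the graph is connected. -/
theorem isPlanar_of_rotation [DecidableRel G.Adj] (σ : Fin (n + 1) → Equiv.Perm (Fin (n + 1)))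
    (face : Fin (n + 1) → Fin (n + 1) → ℕ) (F k : ℕ)
    (hσ : ∀ v w, G.Adj v (σ v w) ↔ G.Adj v w)
    (hcycle : ∀ v w, G.Adj v w → ∀ w', G.Adj v w' → ∃ i < k, (σ v)^[i] w = w')
    (hface : ∀ v w, G.Adj v w → face w (σ w v) = face v w)
    (horbit : ∀ v w, G.Adj v w → ∀ v' w', G.Adj v' w' → face v' w' = face v w →
      ∃ i < k, (fun p : Fin (n + 1) × Fin (n + 1) => (p.2, σ p.2 p.1))^[i] (v, w) = (v', w'))
    (hF : ((Finset.univ.filter fun p : Fin (n + 1) × Fin (n + 1) => G.Adj p.1 p.2).image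
      fun p => face p.1 p.2).card = F)
    (hconn : ∀ v : Fin (n + 1), v ≠ 0 → ∃ w < v, G.Adj v w) (hn : n ≠ 0)
    (hE : (Finset.univ.filter fun p : Fin (n + 1) × Fin (n + 1) => G.Adj p.1 p.2).card + 2 =
      2 * (n + F)) :
    IsPlanar G := by
  let next := rotate σ hσ
  let fnext := next * Function.Involutive.toPerm _ (Dart.symm_involutive (G := G))
  have hfst : ∀ (i : ℕ) (d : G.Dart), ((next ^ i) d).toProd = (d.fst, (σ d.fst)^[i] d.snd) := by
    intro i d
    induction i with
    | zero => rfl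
    | succ i ih =>
      rw [pow_succ', Equiv.Perm.mul_apply, Function.iterate_succ_apply']
      change (((next ^ i) d).fst, σ ((next ^ i) d).fst ((next ^ i) d).snd) = _
      rw [ih]
  have hfnext : ∀ (i : ℕ) (d : G.Dart), ((fnext ^ i) d).toProd =
      (fun p : Fin (n + 1) × Fin (n + 1) => (p.2, σ p.2 p.1))^[i] d.toProd := by
    intro i d
    induction i with
    | zero => rfl
    | succ i ih =>
      rw [pow_succ', Equiv.Perm.mul_apply, Function.iterate_succ_apply', ← ih]
      rfl
  have hmono : ∀ (i : ℕ) (d : G.Dart), face ((fnext ^ i) d).fst ((fnext ^ i) d).snd =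
      face d.fst d.snd := by
    intro i d
    induction i with
    | zero => rfl
    | succ i ih =>
      rw [pow_succ', Equiv.Perm.mul_apply, ← ih]
      exact hface _ _ ((fnext ^ i) d).adj
  have hfaces : Nat.card (Quotient (Equiv.Perm.SameCycle.setoid fnext)) = F := by
    have hlift : ∀ d d' : G.Dart, fnext.SameCycle d d' ↔
        face d.fst d.snd = face d'.fst d'.snd := by
      intro d d'
      constructor
      · intro h
        obtain ⟨i, rfl⟩ := h.exists_nat_pow_eq
        exact (hmono i d).symm
      · intro h
        obtain ⟨i, -, hi⟩ := horbit _ _ d.adj _ _ d'.adj h.symm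
        exact ⟨i, by rw [zpow_natCast]; exact Dart.ext _ _ ((hfnext i d).trans hi)⟩
    let S := (Finset.univ.filter fun p : Fin (n + 1) × Fin (n + 1) => G.Adj p.1 p.2).image
      fun p => face p.1 p.2
    let g : Quotient (Equiv.Perm.SameCycle.setoid fnext) → S := fun q =>
      Quotient.lift (s := Equiv.Perm.SameCycle.setoid fnext) (fun d : G.Dart =>
        (⟨face d.fst d.snd, Finset.mem_image.2 ⟨d.toProd, by simp, rfl⟩⟩ : S))
        (fun d d' h => Subtype.ext ((hlift d d').1 h)) q
    have hg : Function.Bijective g := by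
      constructor
      · intro q q' h
        induction q using Quotient.inductionOn with | _ d
        induction q' using Quotient.inductionOn with | _ d'
        exact Quotient.sound ((hlift d d').2 (congrArg Subtype.val h))
      · rintro ⟨m, hm⟩
        obtain ⟨p, hp, rfl⟩ := Finset.mem_image.1 hm
        exact ⟨Quotient.mk _ ⟨p, (Finset.mem_filter.1 hp).2⟩, rfl⟩
    rw [Nat.card_congr (Equiv.ofBijective g hg), Nat.card_eq_fintype_card, Fintype.card_coe]
    exact hF
  refine ⟨⟨next, fun d d' => ?_, ?_⟩⟩
  · constructor
    · intro h
      obtain ⟨i, rfl⟩ := h.exists_nat_pow_eq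
      exact (congrArg Prod.fst (hfst i d)).symm
    · intro h
      obtain ⟨⟨v, w⟩, hvw⟩ := d
      obtain ⟨⟨v', w'⟩, hvw'⟩ := d'
      obtain rfl : v = v' := h
      obtain ⟨i, -, hi⟩ := hcycle v w hvw w' hvw'
      exact ⟨i, by rw [zpow_natCast]; exact Dart.ext _ _ ((hfst i _).trans (Prod.ext rfl hi))⟩
  · have hC := connected_of_exists_lt hconn
    have h1 : Nat.card G.ConnectedComponent = 1 := by
      have := hC.preconnected.subsingleton_connectedComponent
      have : Nonempty G.ConnectedComponent := ⟨G.connectedComponentMk 0⟩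
      exact Nat.card_unique
    have h2 : Nat.card {v : Fin (n + 1) // ∀ w, ¬ G.Adj v w} = 0 := by
      have : IsEmpty {v : Fin (n + 1) // ∀ w, ¬ G.Adj v w} := by
        refine ⟨fun v => ?_⟩
        have : Nontrivial (Fin (n + 1)) := Fin.nontrivial_iff_two_le.2 (by omega)
        obtain ⟨w, hw⟩ := exists_ne v.1
        obtain ⟨p⟩ := hC.preconnected v.1 w
        cases p with
        | nil => exact hw rfl
        | cons h _ => exact v.2 _ h
      exact Nat.card_of_isEmpty
    have h3 : (Finset.univ.filter fun p : Fin (n + 1) × Fin (n + 1) => G.Adj p.1 p.2).card =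
        2 * Nat.card G.edgeSet := by
      rw [Nat.card_eq_fintype_card, ← edgeFinset_card, ← dart_card_eq_twice_card_edges]
      refine Finset.card_bij' (s := Finset.univ.filter _) (t := Finset.univ)
        (fun p hp => ⟨p, (Finset.mem_filter.1 hp).2⟩) (fun d _ => d.toProd) ?_ ?_ ?_ ?_
      · simp
      · intro d _; simp
      · intros; rfl
      · intros; rfl
    rw [hfaces, h1, h2, Nat.card_eq_fintype_card, Fintype.card_fin]
    omega

end Rotation

end PlaneEmbedding

/-! ### A computable model of `G₇` and of the six subgraphs -/

namespace DeltaYK6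

/-- The graph on `Fin 7` with the edges in a given list. -/
def graphOf (L : List (Sym2 (Fin 7))) : SimpleGraph (Fin 7) :=
  fromEdgeSet {e | e ∈ L}

theorem graphOf_adj {L : List (Sym2 (Fin 7))} {a b : Fin 7} :
    (graphOf L).Adj a b ↔ s(a, b) ∈ L ∧ a ≠ b := by simp [graphOf]

instance (L : List (Sym2 (Fin 7))) : DecidableRel (graphOf L).Adj := fun _ _ =>
  decidable_of_iff _ graphOf_adj.symm

/-- The edges of `G₇`, with the vertex `none` denoted by `6`. -/
def edgeList : List (Sym2 (Fin 7)) :=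
  [s(0, 1), s(0, 2), s(1, 2), s(0, 3), s(0, 4), s(0, 5), s(1, 3), s(1, 4), s(1, 5),
    s(2, 3), s(2, 4), s(2, 5), s(3, 6), s(4, 6), s(5, 6)]

/-- The edges that are removed from the model to obtain each of the six subgraphs. -/
def removedList : Fin 6 → List (Sym2 (Fin 7)) :=
  ![[s(5, 6), s(0, 3)], [s(0, 3), s(1, 4), s(2, 5)], [s(0, 3), s(3, 2), s(2, 5)],
    [s(3, 0), s(0, 2), s(2, 5)], [s(6, 5), s(5, 2), s(2, 1)], [s(2, 0), s(0, 3), s(3, 1)]]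

/-- The model of the subgraph `sixSubgraphs i`. -/
abbrev remaining (i : Fin 6) : SimpleGraph (Fin 7) :=
  graphOf (edgeList.filter fun e => e ∉ removedList i)

/-- The edges of Kuratowski subgraphs of the model, one from each orbit of automorphisms that is
needed: two copies of `K₃,₃`, two of `K₃,₃` with one edge subdivided, and `K₅` with one and with two
edges subdivided. -/
def kuratowskiList : Fin 6 → List (Sym2 (Fin 7)) :=
  ![[s(0, 3), s(0, 4), s(0, 5), s(1, 3), s(1, 4), s(1, 5), s(2, 3), s(2, 4), s(2, 5)],
    [s(0, 3), s(0, 4), s(0, 5), s(1, 3), s(1, 4), s(1, 5), s(3, 6), s(4, 6), s(5, 6)],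
    [s(0, 1), s(0, 3), s(0, 4), s(1, 5), s(2, 3), s(2, 4), s(2, 5), s(3, 6), s(4, 6), s(5, 6)],
    [s(0, 1), s(0, 2), s(0, 3), s(1, 4), s(1, 5), s(2, 4), s(2, 5), s(3, 6), s(4, 6), s(5, 6)],
    [s(0, 1), s(0, 2), s(0, 3), s(0, 4), s(1, 2), s(1, 3), s(1, 4), s(2, 3), s(2, 4), s(3, 6),
      s(4, 6)],
    [s(0, 2), s(0, 3), s(0, 4), s(0, 5), s(1, 2), s(1, 3), s(1, 4), s(1, 5), s(2, 4), s(2, 5),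
      s(4, 6), s(5, 6)]]

/-- The Kuratowski subgraphs listed in `kuratowskiList`. -/
abbrev kuratowski (i : Fin 6) : SimpleGraph (Fin 7) := graphOf (kuratowskiList i)

/-- The walk through the vertices in a list. -/
abbrev walk {G : SimpleGraph (Fin 7)} [DecidableRel G.Adj] (l : List (Fin 7))
    (h : l ≠ [] := by decide) (hl : l.IsChain G.Adj := by decide) :
    G.Walk (l.head h) (l.getLast h) :=
  .ofSupport l h hl

/-! ### Configurations in the six subgraphs

The names give the index of the subgraph and the ends of the two edges. -/

def conflict_0_56_03 : ConflictConfiguration (remaining 0) 5 6 0 3 where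
  p := walk [6, 4, 1, 5]
  p' := walk [6, 4, 2, 5]
  q := walk [3, 2, 0]
  q' := walk [3, 1, 0]
  separating :=
    { x := 1, x₁ := 0, x₂ := 3, x₃ := 5, y := 1,
      p₁ := walk [0, 2, 5], p₂ := walk [3, 2, 5], c := walk [1],
      u₁ := walk [0, 4, 6], u₂ := walk [3, 6],
      u₃ := walk [1, 3, 6], u₄ := walk [5] }

def antiConflict_0_03_65 : AntiConflictConfiguration (remaining 0) 0 3 6 5 where
  Q := [{ x := 1, q := walk [1, 2, 4, 1], p := walk [3, 6], p' := walk [5, 0] }]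
  separating :=
    { x := 2, x₁ := 1, x₂ := 4, x₃ := 0, y := 0,
      p₁ := walk [1, 0], p₂ := walk [4, 0], c := walk [0, 1, 4, 0],
      u₁ := walk [1, 3], u₂ := walk [4, 6, 3],
      u₃ := walk [2, 3], u₄ := walk [0] }

def conflict_1_30_14 : ConflictConfiguration (remaining 1) 3 0 1 4 where
  p := walk [0, 2, 3]
  p' := walk [0, 5, 6, 3]
  q := walk [4, 6, 5, 1]
  q' := walk [4, 2, 1]
  separating :=
    { x := 1, x₁ := 2, x₂ := 5, x₃ := 3, y := 1,
      p₁ := walk [2, 4, 6, 3], p₂ := walk [5, 6, 3], c := walk [1],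
      u₁ := walk [2, 0], u₂ := walk [5, 0],
      u₃ := walk [1, 0], u₄ := walk [3] }

def conflict_1_30_25 : ConflictConfiguration (remaining 1) 3 0 2 5 where
  p := walk [0, 1, 3]
  p' := walk [0, 4, 6, 3]
  q := walk [5, 6, 4, 2]
  q' := walk [5, 1, 2]
  separating :=
    { x := 1, x₁ := 2, x₂ := 5, x₃ := 3, y := 1,
      p₁ := walk [2, 4, 6, 3], p₂ := walk [5, 6, 3], c := walk [1],
      u₁ := walk [2, 0], u₂ := walk [5, 0],
      u₃ := walk [1, 0], u₄ := walk [3] }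

def conflict_1_41_25 : ConflictConfiguration (remaining 1) 4 1 2 5 where
  p := walk [1, 0, 4]
  p' := walk [1, 3, 6, 4]
  q := walk [5, 6, 3, 2]
  q' := walk [5, 0, 2]
  separating :=
    { x := 0, x₁ := 5, x₂ := 2, x₃ := 4, y := 0,
      p₁ := walk [5, 6, 4], p₂ := walk [2, 3, 6, 4], c := walk [0],
      u₁ := walk [5, 1], u₂ := walk [2, 1],
      u₃ := walk [0, 1], u₄ := walk [4] }

def antiConflict_2_30_23 : AntiConflictConfiguration (remaining 2) 3 0 2 3 where
  Q := [{ x := 1, q := walk [1, 4, 6, 5, 1], p := walk [0, 2], p' := walk [3] }]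
  separating :=
    { x := 1, x₁ := 4, x₂ := 5, x₃ := 3, y := 1,
      p₁ := walk [4, 6, 3], p₂ := walk [5, 6, 3], c := walk [1],
      u₁ := walk [4, 0], u₂ := walk [5, 0],
      u₃ := walk [1, 0], u₄ := walk [3] }

def conflict_2_30_25 : ConflictConfiguration (remaining 2) 3 0 2 5 where
  p := walk [0, 1, 3]
  p' := walk [0, 4, 6, 3]
  q := walk [5, 6, 4, 2]
  q' := walk [5, 1, 2]
  separating :=
    { x := 1, x₁ := 2, x₂ := 5, x₃ := 3, y := 1,
      p₁ := walk [2, 4, 6, 3], p₂ := walk [5, 6, 3], c := walk [1],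
      u₁ := walk [2, 0], u₂ := walk [5, 0],
      u₃ := walk [1, 0], u₄ := walk [3] }

def antiConflict_2_25_32 : AntiConflictConfiguration (remaining 2) 2 5 3 2 where
  Q := [{ x := 0, q := walk [0, 1, 4, 0], p := walk [5, 6, 3], p' := walk [2] }]
  separating :=
    { x := 0, x₁ := 1, x₂ := 4, x₃ := 2, y := 1,
      p₁ := walk [1, 2], p₂ := walk [4, 2], c := walk [1, 2, 4, 1],
      u₁ := walk [1, 5], u₂ := walk [4, 6, 5],
      u₃ := walk [0, 5], u₄ := walk [2] }

def antiConflict_3_30_02 : AntiConflictConfiguration (remaining 3) 3 0 0 2 where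
  Q := [{ x := 1, q := walk [1, 4, 6, 5, 1], p := walk [0], p' := walk [2, 3] }]
  separating :=
    { x := 1, x₁ := 4, x₂ := 5, x₃ := 3, y := 1,
      p₁ := walk [4, 6, 3], p₂ := walk [5, 6, 3], c := walk [1],
      u₁ := walk [4, 0], u₂ := walk [5, 0],
      u₃ := walk [1, 0], u₄ := walk [3] }

def conflict_3_03_25 : ConflictConfiguration (remaining 3) 0 3 2 5 where
  p := walk [3, 1, 0]
  p' := walk [3, 6, 4, 0]
  q := walk [5, 6, 4, 2]
  q' := walk [5, 1, 2]
  separating :=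
    { x := 4, x₁ := 2, x₂ := 6, x₃ := 0, y := 4,
      p₁ := walk [2, 1, 5, 0], p₂ := walk [6, 5, 0], c := walk [4],
      u₁ := walk [2, 3], u₂ := walk [6, 3],
      u₃ := walk [4, 1, 3], u₄ := walk [0] }

def antiConflict_3_52_20 : AntiConflictConfiguration (remaining 3) 5 2 2 0 where
  Q := [{ x := 1, q := walk [1, 3, 6, 4, 1], p := walk [2], p' := walk [0, 5] }]
  separating :=
    { x := 1, x₁ := 4, x₂ := 3, x₃ := 5, y := 1,
      p₁ := walk [4, 6, 5], p₂ := walk [3, 6, 5], c := walk [1],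
      u₁ := walk [4, 2], u₂ := walk [3, 2],
      u₃ := walk [1, 2], u₄ := walk [5] }

/-- The vertex `5` has only the neighbours `0` and `1`, which are adjacent, so that it may lie on
either side of the edge `01` and the embedding decides which of the two triangles `013` and `014`
separates it from `6`; their sum does in any case. -/
def antiConflict_4_56_25 : AntiConflictConfiguration (remaining 4) 5 6 2 5 where
  Q := [{ x := 0, q := walk [0, 1, 3, 0], p := walk [6, 4, 2], p' := walk [5] },
    { x := 0, q := walk [0, 1, 4, 0], p := walk [6, 3, 2], p' := walk [5] }]
  separating :=
    { x := 0, x₁ := 3, x₂ := 4, x₃ := 5, y := 0,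
      p₁ := walk [3, 1, 5], p₂ := walk [4, 1, 5], c := walk [0],
      u₁ := walk [3, 6], u₂ := walk [4, 6],
      u₃ := walk [0, 3, 6], u₄ := walk [5] }

def conflict_4_56_12 : ConflictConfiguration (remaining 4) 5 6 1 2 where
  p := walk [6, 3, 0, 5]
  p' := walk [6, 4, 0, 5]
  q := walk [2, 4, 1]
  q' := walk [2, 3, 1]
  separating :=
    { x := 1, x₁ := 3, x₂ := 4, x₃ := 0, y := 1,
      p₁ := walk [3, 2, 0], p₂ := walk [4, 2, 0], c := walk [1],
      u₁ := walk [3, 6], u₂ := walk [4, 6],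
      u₃ := walk [1, 3, 6], u₄ := walk [0, 5] }

def antiConflict_4_12_25 : AntiConflictConfiguration (remaining 4) 1 2 2 5 where
  Q := [{ x := 0, q := walk [0, 3, 6, 4, 0], p := walk [2], p' := walk [5, 1] }]
  separating :=
    { x := 0, x₁ := 3, x₂ := 4, x₃ := 1, y := 1,
      p₁ := walk [3, 1], p₂ := walk [4, 1], c := walk [1, 3, 6, 4, 1],
      u₁ := walk [3, 2], u₂ := walk [4, 2],
      u₃ := walk [0, 2], u₄ := walk [1] }

def antiConflict_5_02_30 : AntiConflictConfiguration (remaining 5) 0 2 3 0 where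
  Q := [{ x := 1, q := walk [1, 4, 6, 5, 1], p := walk [2, 3], p' := walk [0] }]
  separating :=
    { x := 4, x₁ := 1, x₂ := 6, x₃ := 0, y := 4,
      p₁ := walk [1, 5, 0], p₂ := walk [6, 5, 0], c := walk [4],
      u₁ := walk [1, 2], u₂ := walk [6, 3, 2],
      u₃ := walk [4, 2], u₄ := walk [0] }

def conflict_5_31_02 : ConflictConfiguration (remaining 5) 3 1 0 2 where
  p := walk [1, 4, 6, 3]
  p' := walk [1, 5, 6, 3]
  q := walk [2, 5, 0]
  q' := walk [2, 4, 0]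
  separating :=
    { x := 4, x₁ := 2, x₂ := 0, x₃ := 6, y := 4,
      p₁ := walk [2, 5, 6], p₂ := walk [0, 5, 6], c := walk [4],
      u₁ := walk [2, 1], u₂ := walk [0, 1],
      u₃ := walk [4, 1], u₄ := walk [6, 3] }

def antiConflict_5_31_03 : AntiConflictConfiguration (remaining 5) 3 1 0 3 where
  Q := [{ x := 2, q := walk [2, 4, 6, 5, 2], p := walk [1, 0], p' := walk [3] }]
  separating :=
    { x := 2, x₁ := 4, x₂ := 5, x₃ := 3, y := 2,
      p₁ := walk [4, 6, 3], p₂ := walk [5, 6, 3], c := walk [2],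
      u₁ := walk [4, 1], u₂ := walk [5, 1],
      u₃ := walk [2, 1], u₄ := walk [3] }

/-! ### Configurations in the Kuratowski subgraphs -/

def kuratowski_0 : SeparatingConfiguration (kuratowski 0)
    [s(0, 3), s(3, 2), s(2, 4), s(4, 0)] 1 1 :=
  { x := 0, x₁ := 4, x₂ := 3, x₃ := 5, y := 0,
    p₁ := walk [4, 2, 5], p₂ := walk [3, 2, 5], c := walk [0],
    u₁ := walk [4, 1], u₂ := walk [3, 1],
    u₃ := walk [0, 3, 1], u₄ := walk [5, 1] }

def kuratowski_1 : SeparatingConfiguration (kuratowski 1)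
    [s(0, 3), s(3, 6), s(6, 4), s(4, 0)] 1 1 :=
  { x := 0, x₁ := 4, x₂ := 3, x₃ := 5, y := 0,
    p₁ := walk [4, 6, 5], p₂ := walk [3, 6, 5], c := walk [0],
    u₁ := walk [4, 1], u₂ := walk [3, 1],
    u₃ := walk [0, 3, 1], u₄ := walk [5, 1] }

def kuratowski_2 : SeparatingConfiguration (kuratowski 2)
    [s(0, 3), s(3, 2), s(2, 4), s(4, 0)] 5 5 :=
  { x := 3, x₁ := 0, x₂ := 2, x₃ := 6, y := 3,
    p₁ := walk [0, 4, 6], p₂ := walk [2, 4, 6], c := walk [3],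
    u₁ := walk [0, 1, 5], u₂ := walk [2, 5],
    u₃ := walk [3, 2, 5], u₄ := walk [6, 5] }

def kuratowski_3 : SeparatingConfiguration (kuratowski 3)
    [s(0, 1), s(1, 4), s(4, 2), s(2, 0)] 6 6 :=
  { x := 1, x₁ := 0, x₂ := 4, x₃ := 5, y := 1,
    p₁ := walk [0, 2, 5], p₂ := walk [4, 2, 5], c := walk [1],
    u₁ := walk [0, 3, 6], u₂ := walk [4, 6],
    u₃ := walk [1, 4, 6], u₄ := walk [5, 6] }

def kuratowski_4 : SeparatingConfiguration (kuratowski 4)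
    [s(0, 1), s(1, 3), s(3, 0)] 4 4 :=
  { x := 0, x₁ := 3, x₂ := 1, x₃ := 2, y := 1,
    p₁ := walk [3, 2], p₂ := walk [1, 2], c := walk [1, 2, 3, 1],
    u₁ := walk [3, 6, 4], u₂ := walk [1, 4],
    u₃ := walk [0, 4], u₄ := walk [2, 4] }

def kuratowski_5 : SeparatingConfiguration (kuratowski 5)
    [s(0, 3), s(3, 1), s(1, 4), s(4, 0)] 5 5 :=
  { x := 4, x₁ := 1, x₂ := 0, x₃ := 2, y := 0,
    p₁ := walk [1, 2], p₂ := walk [0, 2], c := walk [0, 2, 1, 3, 0],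
    u₁ := walk [1, 5], u₂ := walk [0, 5],
    u₃ := walk [4, 6, 5], u₄ := walk [2, 5] }

end DeltaYK6

/-! ### Search for hitting sets -/

namespace DeltaYK6

/-- One branching step of `hittingSearch`: the first element of a list that belongs to the hitting
set is not among those excluded in `k`, and is added to `r`, while its predecessors are added to
`k`. -/
def branch (next : ℕ → ℕ → Bool) (r : ℕ) : List ℕ → ℕ → Bool
  | [], _ => true
  | e :: l, k =>
    if k.testBit e then branch next r l k
    else next (r ||| 2 ^ e) k && branch next r l (k ||| 2 ^ e)

/-- A search for a set of natural numbers that meets every list in `K`, but contains no list in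
`T`. The binary digits of `r` and of `k` record numbers that belong and that do not belong to the
set. The value `true` certifies that no such set exists. -/
def hittingSearch (T K : List (List ℕ)) : ℕ → ℕ → ℕ → Bool
  | 0, _, _ => false
  | n + 1, r, k =>
    T.any (fun t => t.all r.testBit) ||
      match K.find? fun l => l.all fun e => !r.testBit e with
      | none => false
      | some l => branch (hittingSearch T K n) r l k

theorem forall_testBit_or_two_pow {p : ℕ → Prop} {r e : ℕ} (hr : ∀ i, r.testBit i → p i)
    (he : p e) : ∀ i, (r ||| 2 ^ e).testBit i → p i := by
  intro i hi
  rw [Nat.testBit_or, Nat.testBit_two_pow, Bool.or_eq_true, decide_eq_true_eq] at hi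
  rcases hi with hi | rfl
  · exact hr i hi
  · exact he

theorem exists_of_hittingSearch {T K : List (List ℕ)} {S : ℕ → Prop}
    (hS : ∀ l ∈ K, ∃ e ∈ l, S e) (n r k : ℕ) (hr : ∀ i, r.testBit i → S i)
    (hk : ∀ i, k.testBit i → ¬ S i) (h : hittingSearch T K n r k) : ∃ t ∈ T, ∀ e ∈ t, S e := by
  induction n generalizing r k with
  | zero => exact absurd h (by simp [hittingSearch])
  | succ n ih =>
    rw [hittingSearch, Bool.or_eq_true] at h
    rcases h with h | h
    · obtain ⟨t, ht, ht'⟩ := List.any_eq_true.1 h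
      exact ⟨t, ht, fun e he => hr e (List.all_eq_true.1 ht' e he)⟩
    · split at h
      · exact absurd h (by simp)
      · rename_i l hl
        have hex := hS l (List.mem_of_find?_eq_some hl)
        clear hl
        induction l generalizing k with
        | nil => simp at hex
        | cons e l ihl =>
          rw [branch] at h
          split at h
          · rename_i hek
            refine ihl k hk h ?_
            simpa [hk e hek] using hex
          · rw [Bool.and_eq_true] at h
            by_cases he : S e
            · exact ih _ k (forall_testBit_or_two_pow hr he) hk h.1
            · exact ihl _ (forall_testBit_or_two_pow hk he) h.2 (by simpa [he] using hex)

/-! ### Automorphisms of the model and minimal hitting sets -/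

/-- The automorphisms of the model: permutations of `0, 1, 2` and of `3, 4, 5`. -/
def automorphismList : List (Fin 7 → Fin 7) :=
  [(0, 1, 2), (0, 2, 1), (1, 0, 2), (1, 2, 0), (2, 0, 1), (2, 1, 0)].flatMap fun (a, b, c) =>
    [(3, 4, 5), (3, 5, 4), (4, 3, 5), (4, 5, 3), (5, 3, 4), (5, 4, 3)].map fun (d, e, f) =>
      ![a, b, c, d, e, f, 6]

/-- An injective numbering of unordered pairs. -/
def code : Sym2 (Fin 7) → ℕ :=
  Sym2.lift ⟨fun a b => 7 * min a.val b.val + max a.val b.val, fun a b => by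
    dsimp only; rw [min_comm, max_comm]⟩

theorem code_injective : Function.Injective code := by
  intro x y
  induction x with | _ a b
  induction y with | _ c d
  intro h
  have h : 7 * min a.val b.val + max a.val b.val = 7 * min c.val d.val + max c.val d.val := h
  rw [Sym2.eq_iff]
  simp only [Fin.ext_iff]
  omega

/-- The images under all automorphisms of six lists of edges, encoded by `code`. -/
def codedImages (L : Fin 6 → List (Sym2 (Fin 7))) : List (List ℕ) :=
  automorphismList.flatMap fun f => (List.finRange 6).map fun i =>
    (L i).map fun e => code (e.map f)

set_option maxRecDepth 100000 in
/-- A set of edges that meets all images of the Kuratowski subgraphs contains an image of one of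
the six sets of removed edges. -/
theorem hittingSearch_codedImages :
    hittingSearch (codedImages removedList) (codedImages kuratowskiList) 6 0 0 := by
  decide +kernel

theorem forall_mem_automorphismList : ∀ f ∈ automorphismList, Function.Injective f ∧
    ∀ a b, (graphOf edgeList).Adj (f a) (f b) ↔ (graphOf edgeList).Adj a b := by
  have h : automorphismList.all fun f => decide (Function.Injective f ∧
    ∀ a b, (graphOf edgeList).Adj (f a) (f b) ↔ (graphOf edgeList).Adj a b) := by decide +kernel
  exact fun f hf => of_decide_eq_true (List.all_eq_true.1 h f hf)

/-- The vertex `6` is the only one with three non-neighbours, so every automorphism fixes it and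
permutes its non-neighbours `0, 1, 2` and its neighbours `3, 4, 5`. -/
theorem mem_automorphismList (g : graphOf edgeList ≃g graphOf edgeList) :
    ⇑g ∈ automorphismList := by
  have h1 : ∀ v a b c : Fin 7, ¬ (graphOf edgeList).Adj v a → ¬ (graphOf edgeList).Adj v b →
      ¬ (graphOf edgeList).Adj v c → a ≠ v → b ≠ v → c ≠ v → a ≠ b → a ≠ c → b ≠ c →
      v = 6 ∧ a < 3 ∧ b < 3 ∧ c < 3 := by decide +kernel
  have h2 : ∀ a : Fin 7, (graphOf edgeList).Adj 6 a → 3 ≤ a ∧ a < 6 := by decide +kernel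
  have h3 : ∀ a b c : Fin 7, a < 3 → b < 3 → c < 3 → a ≠ b → a ≠ c → b ≠ c →
      ∀ d e f : Fin 7, 3 ≤ d ∧ d < 6 → 3 ≤ e ∧ e < 6 → 3 ≤ f ∧ f < 6 → d ≠ e → d ≠ f → e ≠ f →
      ![a, b, c, d, e, f, 6] ∈ automorphismList := by decide +kernel
  have hadj : ∀ a b, (graphOf edgeList).Adj (g a) (g b) ↔ (graphOf edgeList).Adj a b :=
    fun _ _ => g.map_adj_iff
  have hne : ∀ a b, a ≠ b → g a ≠ g b := fun _ _ => g.injective.ne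
  obtain ⟨h6, hlt⟩ := h1 (g 6) (g 0) (g 1) (g 2) (by rw [hadj]; decide) (by rw [hadj]; decide)
    (by rw [hadj]; decide) (hne _ _ (by decide)) (hne _ _ (by decide)) (hne _ _ (by decide))
    (hne _ _ (by decide)) (hne _ _ (by decide)) (hne _ _ (by decide))
  have h4 : ∀ a, (graphOf edgeList).Adj 6 a → 3 ≤ g a ∧ g a < 6 := by
    intro a ha
    rw [← hadj, h6] at ha
    exact h2 _ ha
  have hg : ⇑g = ![g 0, g 1, g 2, g 3, g 4, g 5, 6] := by
    ext a
    fin_cases a <;> first | rfl | rw [← h6]; rfl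
  rw [hg]
  exact h3 _ _ _ hlt.1 hlt.2.1 hlt.2.2 (hne _ _ (by decide)) (hne _ _ (by decide))
    (hne _ _ (by decide)) _ _ _ (h4 _ (by decide)) (h4 _ (by decide)) (h4 _ (by decide))
    (hne _ _ (by decide)) (hne _ _ (by decide)) (hne _ _ (by decide))

/-- An image of one of the six removed sets that is contained in another one is equal to it. -/
theorem removedList_rigid : ∀ f ∈ automorphismList, ∀ i j,
    (∀ e ∈ removedList j, Sym2.map f e ∈ removedList i) →
      i = j ∧ ∀ e ∈ removedList i, ∃ e' ∈ removedList j, Sym2.map f e' = e := by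
  have h : automorphismList.all fun f => decide (∀ i j,
      (∀ e ∈ removedList j, Sym2.map f e ∈ removedList i) →
        i = j ∧ ∀ e ∈ removedList i, ∃ e' ∈ removedList j, Sym2.map f e' = e) := by
    decide +kernel
  exact fun f hf => of_decide_eq_true (List.all_eq_true.1 h f hf)

theorem adj_of_mem_removedList : ∀ i, ∀ a b, s(a, b) ∈ removedList i →
    (graphOf edgeList).Adj a b := by
  decide +kernel

/-! ### Planarity of the six subgraphs -/

/-- A number that identifies the face of the dart from `v` to `w` in a rotation system: the least
code of a dart of the face. All faces that occur have at most four darts. -/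
def faceCode (σ : Fin 7 → Equiv.Perm (Fin 7)) (v w : Fin 7) : ℕ :=
  (List.range 4).foldl (fun m i =>
    let p := (fun p : Fin 7 × Fin 7 => (p.2, σ p.2 p.1))^[i] (v, w)
    min m (7 * p.1.val + p.2.val)) 49

/-- The cyclic orders of the neighbours of each vertex, in plane embeddings of the six subgraphs. -/
def rotations : Fin 6 → Fin 7 → List (Fin 7) :=
  ![![[1, 4, 2, 5], [0, 5, 2, 3, 4], [0, 4, 3, 1, 5], [1, 2, 6], [0, 1, 6, 2], [0, 2, 1], [3, 4]],
    ![[1, 2, 4, 5], [0, 5, 3, 2], [0, 1, 3, 4], [1, 6, 2], [0, 2, 6], [0, 6, 1], [3, 5, 4]],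
    ![[1, 2, 4, 5], [0, 5, 3, 4, 2], [0, 1, 4], [1, 6], [0, 2, 1, 6], [0, 6, 1], [3, 5, 4]],
    ![[1, 4, 5], [0, 5, 3, 2, 4], [1, 3, 4], [1, 6, 2], [0, 1, 2, 6], [0, 6, 1], [3, 5, 4]],
    ![[1, 3, 2, 4, 5], [0, 5, 4, 3], [0, 3, 4], [0, 1, 6, 2], [0, 2, 6, 1], [0, 1], [3, 4]],
    ![[1, 4, 5], [0, 5, 2, 4], [1, 5, 3, 4], [2, 6], [0, 1, 2, 6], [0, 6, 2, 1], [3, 5, 4]]]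

theorem isPlanar_remaining (i : Fin 6) : IsPlanar (remaining i) := by
  refine PlaneEmbedding.isPlanar_of_rotation (fun v => (rotations i v).formPerm)
    -- The first graph has 13 edges and 8 faces, the others have 12 edges and 7 faces.
    (faceCode fun v => (rotations i v).formPerm) (if i = 0 then 8 else 7) 5
    ?_ ?_ ?_ ?_ ?_ ?_ (by decide) ?_ <;>
  revert i <;> decide +kernel

/-! ### The maximal planar subgraphs -/

set_option synthInstance.maxSize 10000 in
set_option synthInstance.maxHeartbeats 400000 in
theorem G7_adj : ∀ a b : Fin 7, G7.Adj (finSuccEquivLast a) (finSuccEquivLast b) ↔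
    (graphOf edgeList).Adj a b := by
  simp only [G7, deltaY, fromRel_adj, top_adj]
  decide +kernel

/-- The isomorphism of the model with `G₇`, which takes `6` to `none`. -/
def modelIso : graphOf edgeList ≃g G7 where
  toEquiv := finSuccEquivLast
  map_rel_iff' := G7_adj _ _

/-- The labelling of the vertices of `G₇` that is obtained from the standard one by an
automorphism. -/
abbrev labelling (φ : G7 ≃g G7) : graphOf edgeList ≃g G7 :=
  modelIso.trans φ

theorem s_mem_removedEdges (i : Fin 6) :
    ∀ a b : Fin 7, s(modelIso a, modelIso b) ∈ removedEdges i ↔ s(a, b) ∈ removedList i := by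
  fin_cases i <;>
    simp only [Fin.reduceFinMk, Fin.zero_eta, Fin.mk_one, removedEdges, removedList,
      Matrix.cons_val, Set.mem_insert_iff, Set.mem_singleton_iff] <;>
    decide +kernel

theorem sixSubgraphs_adj (i : Fin 6) (a b : Fin 7) :
    (sixSubgraphs i).Adj (modelIso a) (modelIso b) ↔ (remaining i).Adj a b := by
  rw [sixSubgraphs, Subgraph.deleteEdges_adj, Subgraph.top_adj, s_mem_removedEdges,
    modelIso.map_adj_iff, graphOf_adj, graphOf_adj, List.mem_filter, decide_eq_true_eq]
  tauto

theorem map_sixSubgraphs_adj (i : Fin 6) (φ : G7 ≃g G7) (a b : Fin 7) :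
    ((sixSubgraphs i).map φ.toHom).Adj (labelling φ a) (labelling φ b) ↔
      (remaining i).Adj a b := by
  rw [← sixSubgraphs_adj, Subgraph.map_adj]
  exact Relation.map_apply_apply φ.injective φ.injective _ _ _

theorem map_sixSubgraphs_verts (i : Fin 6) (φ : G7 ≃g G7) :
    ((sixSubgraphs i).map φ.toHom).verts = Set.univ := by
  rw [Subgraph.map_verts, sixSubgraphs, Subgraph.deleteEdges_verts, Subgraph.verts_top,
    Set.image_univ]
  exact φ.surjective.range_eq

/-- A subgraph is contained in an image of one of the six subgraphs if and only if it lacks the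
images of the removed edges. -/
theorem le_map_sixSubgraphs_iff (M : G7.Subgraph) (i : Fin 6) (φ : G7 ≃g G7) :
    M ≤ (sixSubgraphs i).map φ.toHom ↔
      ∀ e ∈ removedList i, Sym2.map (labelling φ) e ∉ M.edgeSet := by
  constructor
  · intro h e he heM
    induction e with | _ a b
    have := (map_sixSubgraphs_adj i φ a b).1 (h.2 heM)
    rw [graphOf_adj, List.mem_filter, decide_eq_true_eq] at this
    exact this.1.2 he
  · intro h
    refine ⟨by rw [map_sixSubgraphs_verts]; exact Set.subset_univ _, fun u v huv => ?_⟩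
    obtain ⟨a, rfl⟩ := (labelling φ).surjective u
    obtain ⟨b, rfl⟩ := (labelling φ).surjective v
    rw [map_sixSubgraphs_adj, graphOf_adj, List.mem_filter, decide_eq_true_eq]
    have hab := graphOf_adj.1 ((labelling φ).map_adj_iff.1 huv.adj_sub)
    exact ⟨⟨hab.1, fun he => h _ he huv⟩, hab.2⟩

theorem isPlanar_map_sixSubgraphs (i : Fin 6) (φ : G7 ≃g G7) :
    IsPlanar ((sixSubgraphs i).map φ.toHom).spanningCoe := by
  obtain ⟨P⟩ := isPlanar_remaining i
  exact ⟨P.ofIso ⟨(labelling φ).toEquiv, map_sixSubgraphs_adj i φ _ _⟩⟩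

theorem not_isPlanar_of_kuratowski (k : Fin 6) {V : Type*} [Finite V] {N : SimpleGraph V}
    (F : kuratowski k →g N) (hF : Function.Injective F) : ¬ IsPlanar N := by
  classical
  fin_cases k
  · exact (kuratowski_0.map F hF).not_isPlanar
  · exact (kuratowski_1.map F hF).not_isPlanar
  · exact (kuratowski_2.map F hF).not_isPlanar
  · exact (kuratowski_3.map F hF).not_isPlanar
  · exact (kuratowski_4.map F hF).not_isPlanar
  · exact (kuratowski_5.map F hF).not_isPlanar

/-- The automorphism of `G₇` given by an automorphism of the model. -/
noncomputable def automorphism (f : Fin 7 → Fin 7) (hf : f ∈ automorphismList) : G7 ≃g G7 :=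
  modelIso.symm.trans (RelIso.trans
    ⟨Equiv.ofBijective f (Finite.injective_iff_bijective.1 (forall_mem_automorphismList f hf).1),
      (forall_mem_automorphismList f hf).2 _ _⟩ modelIso)

theorem automorphism_modelIso (f : Fin 7 → Fin 7) (hf : f ∈ automorphismList) (a : Fin 7) :
    labelling (automorphism f hf) a = modelIso (f a) := by
  change modelIso (f (modelIso.symm (modelIso a))) = modelIso (f a)
  rw [RelIso.symm_apply_apply]

/-- The edges that a planar subgraph lacks form a hitting set for the Kuratowski subgraphs. -/
theorem exists_le_map_sixSubgraphs (M : G7.Subgraph) (hM : IsPlanar M.spanningCoe) :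
    ∃ (i : Fin 6) (φ : G7 ≃g G7), M ≤ (sixSubgraphs i).map φ.toHom := by
  let S : ℕ → Prop := fun n => ∃ e : Sym2 (Fin 7), code e = n ∧ e.map modelIso ∉ M.edgeSet
  have hS : ∀ l ∈ codedImages kuratowskiList, ∃ n ∈ l, S n := by
    intro l hl
    obtain ⟨f, hf, hl⟩ := List.mem_flatMap.1 hl
    obtain ⟨k, -, rfl⟩ := List.mem_map.1 hl
    by_contra! hcon
    have hcon' : ∀ e ∈ kuratowskiList k, Sym2.map modelIso (e.map f) ∈ M.edgeSet := by
      intro e he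
      by_contra h
      exact hcon _ (List.mem_map_of_mem he) ⟨_, rfl, h⟩
    refine not_isPlanar_of_kuratowski k (N := M.spanningCoe)
      ⟨fun a => modelIso (f a), fun {a b} hab => ?_⟩
      (modelIso.injective.comp (forall_mem_automorphismList f hf).1) hM
    exact hcon' s(a, b) (graphOf_adj.1 hab).1
  obtain ⟨t, ht, htS⟩ := exists_of_hittingSearch hS 6 0 0 (by simp) (by simp)
    hittingSearch_codedImages
  obtain ⟨f, hf, ht⟩ := List.mem_flatMap.1 ht
  obtain ⟨i, -, rfl⟩ := List.mem_map.1 ht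
  refine ⟨i, automorphism f hf, (le_map_sixSubgraphs_iff _ _ _).2 fun e he => ?_⟩
  obtain ⟨e', he', h⟩ := htS _ (List.mem_map_of_mem he)
  rw [code_injective he', Sym2.map_map] at h
  rwa [show ⇑(labelling (automorphism f hf)) = modelIso ∘ f from
    funext (automorphism_modelIso f hf)]

/-- Between images of the six subgraphs under automorphisms, no inclusions hold but equalities of
images of the same subgraph. -/
theorem eq_and_le_of_map_le_map (i j : Fin 6) (φ ψ : G7 ≃g G7)
    (h : (sixSubgraphs i).map φ.toHom ≤ (sixSubgraphs j).map ψ.toHom) :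
    i = j ∧ (sixSubgraphs j).map ψ.toHom ≤ (sixSubgraphs i).map φ.toHom := by
  let g : graphOf edgeList ≃g graphOf edgeList := (labelling ψ).trans (labelling φ).symm
  have hg : ∀ a, labelling φ (g a) = labelling ψ a := fun a =>
    (labelling φ).apply_symm_apply _
  have hmap : ∀ e : Sym2 (Fin 7),
      Sym2.map (labelling φ) (Sym2.map g e) = Sym2.map (labelling ψ) e := by
    intro e
    rw [Sym2.map_map]
    exact congrFun (congrArg Sym2.map (funext hg)) e
  rw [le_map_sixSubgraphs_iff] at h
  obtain ⟨rfl, h'⟩ := removedList_rigid g (mem_automorphismList g) i j fun e he => by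
    have h1 := h e he
    rw [← hmap] at h1
    induction e with | _ a b
    by_contra h2
    apply h1
    refine (map_sixSubgraphs_adj i φ (g a) (g b)).2 ?_
    rw [graphOf_adj, List.mem_filter, decide_eq_true_eq]
    have := graphOf_adj.1 (g.map_adj_iff.2 (adj_of_mem_removedList j a b he))
    exact ⟨⟨this.1, h2⟩, this.2⟩
  refine ⟨rfl, (le_map_sixSubgraphs_iff _ _ _).2 fun e he => ?_⟩
  obtain ⟨e', he', rfl⟩ := h' e he
  rw [hmap]
  exact (le_map_sixSubgraphs_iff _ _ _).1 le_rfl e' he'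

theorem isMaximalPlanarSubgraph_iff (M : G7.Subgraph) : IsMaximalPlanarSubgraph M ↔
    ∃ (i : Fin 6) (φ : G7 ≃g G7), M = (sixSubgraphs i).map φ.toHom := by
  constructor
  · intro h
    obtain ⟨i, φ, hle⟩ := exists_le_map_sixSubgraphs M h.prop
    exact ⟨i, φ, h.eq_of_le (isPlanar_map_sixSubgraphs i φ) hle⟩
  · rintro ⟨i, φ, rfl⟩
    refine ⟨isPlanar_map_sixSubgraphs i φ, fun K hK hle => ?_⟩
    obtain ⟨j, ψ, hK'⟩ := exists_le_map_sixSubgraphs K hK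
    exact hK'.trans (eq_and_le_of_map_le_map i j φ ψ (hle.trans hK')).2

/-! ### Unbalanced strong conflict graphs -/

section Unbalanced

variable {V : Type*} [Finite V] {G N : SimpleGraph V} {P : PlaneEmbedding N}

theorem not_isBalanced_of_double {e f : Sym2 V} (he : e ∈ G.edgeSet \ N.edgeSet)
    (hf : f ∈ G.edgeSet \ N.edgeSet) (hef : e ≠ f)
    (h : P.StronglyConflict e f ∨ P.StronglyConflict f e)
    (h' : P.StronglyAntiConflict e f ∨ P.StronglyAntiConflict f e) :
    ¬ (strongConflictGraph G P).IsBalanced := by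
  intro hB
  have := hB 1 ![⟨e, he⟩, ⟨f, hf⟩] ![-1, 1]
    (by
      intro a b hab
      fin_cases a <;> fin_cases b <;> simp [hef, hef.symm] at hab ⊢)
    (by
      intro a
      fin_cases a
      · exact ⟨fun h => hef (congrArg Subtype.val h), Or.inl ⟨rfl, h⟩⟩
      · exact ⟨fun h => hef (congrArg Subtype.val h).symm, Or.inr ⟨rfl, h'.symm⟩⟩)
  exact absurd this (by decide)

theorem not_isBalanced_of_triangle {e f g : Sym2 V} (he : e ∈ G.edgeSet \ N.edgeSet)
    (hf : f ∈ G.edgeSet \ N.edgeSet) (hg : g ∈ G.edgeSet \ N.edgeSet) (hef : e ≠ f) (hfg : f ≠ g)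
    (hge : g ≠ e) (s : Fin 3 → ℤˣ) (hs : ∏ i, s i = -1)
    (h₀ : (strongConflictGraph G P).Adj (s 0) ⟨e, he⟩ ⟨f, hf⟩)
    (h₁ : (strongConflictGraph G P).Adj (s 1) ⟨f, hf⟩ ⟨g, hg⟩)
    (h₂ : (strongConflictGraph G P).Adj (s 2) ⟨g, hg⟩ ⟨e, he⟩) :
    ¬ (strongConflictGraph G P).IsBalanced := by
  intro hB
  have := hB 2 ![⟨e, he⟩, ⟨f, hf⟩, ⟨g, hg⟩] s
    (by
      intro a b hab
      fin_cases a <;> fin_cases b <;>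
        simp [hef, hef.symm, hfg, hfg.symm, hge, hge.symm] at hab ⊢)
    (by
      intro a
      fin_cases a
      · exact h₀
      · exact h₁
      · exact h₂)
  rw [hs] at this
  exact absurd this (by decide)

theorem not_isBalanced_of_conflicts {e f g : Sym2 V} (he : e ∈ G.edgeSet \ N.edgeSet)
    (hf : f ∈ G.edgeSet \ N.edgeSet) (hg : g ∈ G.edgeSet \ N.edgeSet) (hef : e ≠ f) (hfg : f ≠ g)
    (hge : g ≠ e) (h₀ : P.StronglyConflict e f) (h₁ : P.StronglyConflict f g)
    (h₂ : P.StronglyConflict e g) : ¬ (strongConflictGraph G P).IsBalanced :=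
  not_isBalanced_of_triangle he hf hg hef hfg hge ![-1, -1, -1] (by decide)
    ⟨fun h => hef (congrArg Subtype.val h), .inl ⟨rfl, .inl h₀⟩⟩
    ⟨fun h => hfg (congrArg Subtype.val h), .inl ⟨rfl, .inl h₁⟩⟩
    ⟨fun h => hge (congrArg Subtype.val h), .inl ⟨rfl, .inr h₂⟩⟩

theorem not_isBalanced_of_antiConflicts {e f g : Sym2 V} (he : e ∈ G.edgeSet \ N.edgeSet)
    (hf : f ∈ G.edgeSet \ N.edgeSet) (hg : g ∈ G.edgeSet \ N.edgeSet) (hef : e ≠ f) (hfg : f ≠ g)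
    (hge : g ≠ e) (h₀ : P.StronglyAntiConflict e f ∨ P.StronglyAntiConflict f e)
    (h₁ : P.StronglyAntiConflict f g ∨ P.StronglyAntiConflict g f)
    (h₂ : P.StronglyConflict e g ∨ P.StronglyConflict g e) :
    ¬ (strongConflictGraph G P).IsBalanced :=
  not_isBalanced_of_triangle he hf hg hef hfg hge ![1, 1, -1] (by decide)
    ⟨fun h => hef (congrArg Subtype.val h), .inr ⟨rfl, h₀⟩⟩
    ⟨fun h => hfg (congrArg Subtype.val h), .inr ⟨rfl, h₁⟩⟩
    ⟨fun h => hge (congrArg Subtype.val h), .inl ⟨rfl, h₂.symm⟩⟩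

end Unbalanced

/-- The strong conflict graph is unbalanced for every plane embedding of a graph that contains one
of the six models, if the removed edges are its fragments. -/
theorem not_isBalanced_of_hom {V : Type*} [Finite V] [DecidableEq V] {G N : SimpleGraph V}
    (P : PlaneEmbedding N) (i : Fin 6) (F : remaining i →g N) (hF : Function.Injective F)
    (hG : ∀ e ∈ removedList i, e.map F ∈ G.edgeSet \ N.edgeSet) :
    ¬ (strongConflictGraph G P).IsBalanced := by
  have hne : ∀ e e' : Sym2 (Fin 7), e ≠ e' → e.map F ≠ e'.map F := fun _ _ =>
    (Sym2.map.injective hF).ne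
  fin_cases i
  · exact not_isBalanced_of_double (hG s(5, 6) (by decide)) (hG s(0, 3) (by decide))
      (hne _ _ (by decide)) (.inl (conflict_0_56_03.stronglyConflict P F hF))
      (.inr (antiConflict_0_03_65.stronglyAntiConflict P F hF))
  · exact not_isBalanced_of_conflicts (hG s(0, 3) (by decide)) (hG s(1, 4) (by decide))
      (hG s(2, 5) (by decide)) (hne _ _ (by decide)) (hne _ _ (by decide)) (hne _ _ (by decide))
      (conflict_1_30_14.stronglyConflict P F hF)
      (conflict_1_41_25.stronglyConflict P F hF)
      (conflict_1_30_25.stronglyConflict P F hF)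
  · exact not_isBalanced_of_antiConflicts (hG s(0, 3) (by decide)) (hG s(2, 3) (by decide))
      (hG s(2, 5) (by decide)) (hne _ _ (by decide)) (hne _ _ (by decide)) (hne _ _ (by decide))
      (.inl (antiConflict_2_30_23.stronglyAntiConflict P F hF))
      (.inr (antiConflict_2_25_32.stronglyAntiConflict P F hF))
      (.inl (conflict_2_30_25.stronglyConflict P F hF))
  · exact not_isBalanced_of_antiConflicts (hG s(0, 3) (by decide)) (hG s(0, 2) (by decide))
      (hG s(2, 5) (by decide)) (hne _ _ (by decide)) (hne _ _ (by decide)) (hne _ _ (by decide))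
      (.inl (antiConflict_3_30_02.stronglyAntiConflict P F hF))
      (.inr (antiConflict_3_52_20.stronglyAntiConflict P F hF))
      (.inl (conflict_3_03_25.stronglyConflict P F hF))
  · exact not_isBalanced_of_antiConflicts (hG s(5, 6) (by decide)) (hG s(2, 5) (by decide))
      (hG s(1, 2) (by decide)) (hne _ _ (by decide)) (hne _ _ (by decide)) (hne _ _ (by decide))
      (.inl (antiConflict_4_56_25.stronglyAntiConflict P F hF))
      (.inr (antiConflict_4_12_25.stronglyAntiConflict P F hF))
      (.inl (conflict_4_56_12.stronglyConflict P F hF))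
  · exact not_isBalanced_of_antiConflicts (hG s(0, 2) (by decide)) (hG s(0, 3) (by decide))
      (hG s(1, 3) (by decide)) (hne _ _ (by decide)) (hne _ _ (by decide)) (hne _ _ (by decide))
      (.inl (antiConflict_5_02_30.stronglyAntiConflict P F hF))
      (.inr (antiConflict_5_31_03.stronglyAntiConflict P F hF))
      (.inr (conflict_5_31_02.stronglyConflict P F hF))

end DeltaYK6

open DeltaYK6 in
theorem proposition5 :
    (∀ M : G7.Subgraph, IsMaximalPlanarSubgraph M ↔
      ∃ (i : Fin 6) (φ : G7 ≃g G7), M = (sixSubgraphs i).map φ.toHom) ∧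
    (∀ (i j : Fin 6) (φ : G7 ≃g G7),
      sixSubgraphs i = (sixSubgraphs j).map φ.toHom → i = j) ∧
    (∀ M : G7.Subgraph, IsMaximalPlanarSubgraph M →
      ∀ P : PlaneEmbedding M.spanningCoe, ¬ (strongConflictGraph G7 P).IsBalanced) := by
  refine ⟨isMaximalPlanarSubgraph_iff, fun i j φ h => ?_, fun M hM P => ?_⟩
  · refine (eq_and_le_of_map_le_map i j (Iso.refl) φ (le_of_eq ?_)).1
    rw [← h]
    exact Subgraph.map_id _
  · obtain ⟨i, φ, rfl⟩ := (isMaximalPlanarSubgraph_iff M).1 hM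
    refine not_isBalanced_of_hom P i ⟨labelling φ, (map_sixSubgraphs_adj i φ _ _).2⟩
      (labelling φ).injective fun e he => ⟨?_, ?_⟩
    · induction e with | _ a b
      exact (labelling φ).map_adj_iff.2 (adj_of_mem_removedList i a b he)
    · exact (le_map_sixSubgraphs_iff _ i φ).1 le_rfl e he
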